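/- For $0<|q|<1$ let $(z;q)_\infty=\prod_{n\ge0}(1-q^nz)$, $\;c_q=\dfrac{(q;q)_\infty^2}{(q^2;q^2)_\infty}$, $\;G_q(z)=\dfrac{(-qz^{-1};q)_\infty}{(z;q)_\infty}$ and, for $|z|<1$, $\mathrm{Li}_2(z;q)=\sum_{n\ge1}\dfrac{z^n}{n(1-q^n)}$. Let $B_k(x)$ be the Bernoulli polynomials, $\frac{te^{xt}}{e^t-1}=\sum_{k\ge0}B_k(x)\frac{t^k}{k!}$, and $B_k=B_k(0)$. Let $\mathrm{Li}_2(z)=\sum_{n\ge1}z^n/n^2$ for $|z|\le1$, $\mathrm{Li}_0(z)=\frac{z}{1-z}$ and $\mathrm{Li}_k(z)=z\frac{d}{dz}\mathrm{Li}_{k+1}(z)$ for integers $k<0$. Let $L(e^{i\theta})=-\int_0^\theta\log|2\sin x|\,dx$ be the Lobachevsky function on the unit circle (well defined by $\pi$-periodicity), and let $\mathrm{Arg}\,\omega\in(-\pi,\pi]$ be the principal argument; $\log$ is the principal branch. **Theorem.** Let $m\ge0$ be an arbitrary integer and let $\hbar$ be a negative real parameter. As $\hbar\to0^-$: 1. $\displaystyle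 c_{e^\hbar}=\exp\Bigl[\frac{\pi^2}{4}\hbar^{-1}-\frac12\log(-\hbar)+\log\sqrt{4\pi}+O(\hbar^\infty)\Bigr]$, where $O(\hbar^\infty)$ denotes a term which is $O(\hbar^n)$ for every $n\ge0$. 2. For $a\in\mathbb C\setminus\{0,-1,-2,\dots\}$, $$G_{e^\hbar}(e^{a\hbar})=\exp\Bigl[-\frac{\pi^2}{4}\hbar^{-1}+(a-\tfrac12)\log(-\hbar)+\log\frac{\Gamma(a)}{\sqrt{2\pi}}+(a-\tfrac12)\log2+\sum_{k=1}^m\frac{B_{2k}B_{2k+1}(a)}{2k\,(2k+1)!}2^{2k}\hbar^{2k}+O(\hbar^{2(m+1)})\Bigr].$$ 3. For $a\in\mathbb C\setminus\{1,2,3,\dots\}$, $$G_{e^\hbar}(-e^{a\hbar})=\exp\Bigl[\frac{\pi^2}{4}\hbar^{-1}+(a-\tfrac12)\log(-\hbar)-\log\frac{\Gamma(1-a)}{\sqrt{2\pi}}+(a-\tfrac12)\log2+\sum_{k=1}^m\frac{B_{2k}B_{2k+1}(a)}{2k\,(2k+1)!}2^{2k}\hbar^{2k}+O(\hbar^{2(m+1)})\Bigr],$$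 while for $a\in\{1,2,3,\dots\}$ (where $1/\Gamma(1-a)=0$) one has $G_{e^\hbar}(-e^{a\hbar})=0$ for all $\hbar<0$. The expansions in 2 and 3 hold uniformly for $a$ in any compact subset $K$ of $\mathbb C$ (with the exceptional values just listed removed from $K$): the constant in the error term and the range of $\hbar$ depend only on $m$ and $K$. 4. If $|\omega|=1$, $\omega\notin\mathbb R$ and $a\in(0,1)$, then $$G_{e^\hbar}(\omega e^{a\hbar})=\exp\Bigl[\bigl(\tfrac{\pi}{2}|\mathrm{Arg}\,\omega|-\tfrac{\pi^2}{4}-iL(\omega)\bigr)\hbar^{-1}+(a-\tfrac12)\bigl(\log|2\,\mathrm{Im}\,\omega|-i\tfrac{\pi}{2}\,\mathrm{sgn}\,\mathrm{Im}\,\omega\bigr)+\frac{B_2(a)\,\mathrm{Re}\,\omega}{2i\,\mathrm{Im}\,\omega}\hbar-\sum_{k=2}^m\frac{2^kB_{k+1}(a)}{(k+1)!}\mathrm{Li}_{1-k}(\omega^2)\hbar^k+O(\hbar^{m+1})\Bigr].$$ 5. If $|\omega|=1$, $\omega\ne1$ and $a\in\mathbb C$ with $\mathrm{Re}\,a>0$,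 then $$\mathrm{Li}_2(\omega e^{a\hbar};e^\hbar)=-\mathrm{Li}_2(\omega)\hbar^{-1}+(a-\tfrac12)\log(1-\omega)-\sum_{k=1}^m\frac{B_{k+1}(a)}{(k+1)!}\mathrm{Li}_{1-k}(\omega)\hbar^k+O(\hbar^{m+1}).$$ -/

import Mathlib

open Filter Topology Asymptotics

/-- The `q`-Pochhammer symbol `(z; q)_∞ = ∏_{n ≥ 0} (1 - q ^ n z)`, for `|q| < 1`. -/
noncomputable def qPoch (z q : ℂ) : ℂ := ∏' n : ℕ, (1 - q ^ n * z)

/-- The `q`-dilogarithm `Li₂(z; q) = ∑_{n ≥ 1} z ^ n / (n (1 - q ^ n))`, for `|z| < 1` and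
`0 < |q| < 1`. -/
noncomputable def qDilog (z q : ℂ) : ℂ :=
  ∑' n : ℕ, z ^ (n + 1) / (((n : ℂ) + 1) * (1 - q ^ (n + 1)))

/-- `G_q(z) = (-q z⁻¹; q)_∞ / (z; q)_∞`, for `0 < |q| < 1` and `z ≠ 0`, away from the poles
`z = q ^ (-n)`, `n ≥ 0`. -/
noncomputable def Gfun (q z : ℂ) : ℂ := qPoch (-q * z⁻¹) q / qPoch z q

/-- The constant `c_q = (q; q)_∞ ^ 2 / (q ^ 2; q ^ 2)_∞`, for `0 < |q| < 1`. -/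
noncomputable def cConst (q : ℂ) : ℂ := qPoch q q ^ 2 / qPoch (q ^ 2) (q ^ 2)

/-- The polylogarithms of non-positive index: `polylogNonpos n` is `Li_{-n}`, given by
`Li_0(z) = z / (1 - z)` and `Li_{k}(z) = z (d/dz) Li_{k+1}(z)` for `k < 0`, where `z ≠ 1`. -/
noncomputable def polylogNonpos : ℕ → ℂ → ℂ
  | 0 => fun z => z / (1 - z)
  | n + 1 => fun z => z * deriv (polylogNonpos n) z

/-- The polylogarithm `Li_k(z)`. For `k > 0` it is the power series `∑_{n ≥ 1} z ^ n / n ^ k`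
(`|z| < 1`, or `|z| ≤ 1` when `k ≥ 2`); for `k ≤ 0` it is the rational function determined by
`Li_0(z) = z / (1 - z)` and `Li_k(z) = z (d/dz) Li_{k+1}(z)`. -/
noncomputable def polylog (k : ℤ) (z : ℂ) : ℂ :=
  if 0 < k then ∑' n : ℕ, z ^ (n + 1) / ((n : ℂ) + 1) ^ k else polylogNonpos (-k).toNat z

/-- The value `B_k(a)` of the `k`th Bernoulli polynomial at a complex number. -/
noncomputable def bernoulliValue (k : ℕ) (a : ℂ) : ℂ := Polynomial.aeval a (Polynomial.bernoulli k)

/-- The Lobachevsky function `Л(θ) = -∫_0^θ log |2 sin x| dx`. -/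
noncomputable def lobachevsky (θ : ℝ) : ℝ := -∫ x in (0 : ℝ)..θ, Real.log |2 * Real.sin x|

/-- The Lobachevsky function on the unit circle, `e^{iθ} ↦ Л(θ)`. As `Л` is `π`-periodic, any
argument of the point may be used; see `circleLobachevsky_exp`. -/
noncomputable def circleLobachevsky (ω : ℂ) : ℝ := lobachevsky (Complex.arg ω)

theorem intervalIntegrable_log_two_sin (a b : ℝ) :
    IntervalIntegrable (fun x : ℝ => Real.log |2 * Real.sin x|) MeasureTheory.volume a b := by
  simp only [Real.log_abs]
  apply MeromorphicOn.intervalIntegrable_log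
  intro x _
  exact AnalyticAt.meromorphicAt (by fun_prop)

theorem integral_log_two_sin : ∫ x in (0 : ℝ)..Real.pi, Real.log |2 * Real.sin x| = 0 := by
  have h : ∫ x in (0 : ℝ)..Real.pi, Real.log |2 * Real.sin x|
      = ∫ x in (0 : ℝ)..Real.pi, (Real.log 2 + Real.log (Real.sin x)) := by
    apply intervalIntegral.integral_congr_ae
    have hne : ∀ᵐ x : ℝ, x ≠ Real.pi := by simp [MeasureTheory.ae_iff]
    filter_upwards [hne] with x hx hmem
    rw [Set.uIoc_of_le Real.pi_pos.le] at hmem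
    have hs := Real.sin_pos_of_pos_of_lt_pi hmem.1 (lt_of_le_of_ne hmem.2 hx)
    rw [Real.log_abs, Real.log_mul two_ne_zero hs.ne']
  have hi : IntervalIntegrable (fun x : ℝ => Real.log (Real.sin x)) MeasureTheory.volume 0
      Real.pi := intervalIntegrable_log_sin
  rw [h, intervalIntegral.integral_add (by simp) hi, integral_log_sin_zero_pi]
  simp
  ring

theorem lobachevsky_periodic : Function.Periodic lobachevsky Real.pi := by
  intro θ
  have hp : Function.Periodic (fun x : ℝ => Real.log |2 * Real.sin x|) Real.pi := by
    intro x
    simp [Real.sin_add_pi]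
  have h1 := hp.intervalIntegral_add_eq θ 0
  rw [zero_add, integral_log_two_sin] at h1
  unfold lobachevsky
  rw [← intervalIntegral.integral_add_adjacent_intervals
    (intervalIntegrable_log_two_sin 0 θ) (intervalIntegrable_log_two_sin θ (θ + Real.pi)), h1,
    add_zero]

theorem circleLobachevsky_exp (θ : ℝ) :
    circleLobachevsky (Complex.exp (θ * Complex.I)) = lobachevsky θ := by
  unfold circleLobachevsky
  rw [Complex.arg_exp_mul_I, toIocMod]
  have h := (lobachevsky_periodic.zsmul (2 * toIocDiv Real.two_pi_pos (-Real.pi) θ)).sub_eq θ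
  rw [← h]
  congr 2
  simp only [zsmul_eq_mul]
  push_cast
  ring

/-! ### Taylor expansion along a family of successive derivatives -/

/-! Put `t = -ħ > 0` and `q = e⁻ᵗ`. Formally `log (ω q ^ a; q)_∞ = ∑_{j ≥ 0} f ((a + j) t)` with `f
z = log (1 - ω e⁻ᶻ)`, and Euler–Maclaurin with shift `a` gives `t⁻¹ ∫_0^∞ f - ∑_{k ≥ 1} B_k(a)/k! *
t ^ (k-1) * f^(k-1)(0)`. This is proved for finite sums with an error uniform in the number `N` of
terms and in bounded complex `a` (`RayRegular.euler_maclaurin`); then `N → ∞`.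

For `|ω| = 1`, `ω ≠ 1`, the function `f` is holomorphic near `[0, ∞)`, its integral is `-Li₂(ω)`,
and its derivatives at `0` are polylogarithms of nonpositive index. This gives the `q`-dilogarithm
expansion.

For `ω = 1` there is a logarithmic singularity at `0`. Writing `1 - e⁻ᶻ = z e^{g(z)}` with `g =
logExpQuot`, the factors `(a + j) t` produce `Γ(a)` by Gauss' limit and Stirling
(`tendsto_prod_gamma`), while `g` is regular with `g^(n)(0) = B_n / n`. Limits are taken at the
level of exponentials, so no branch of the logarithm of an infinite product has to be chosen.

`G_q(q ^ a)` is the quotient of the cases `ω = -1` (shift `1 - a`) and `ω = 1` (shift `a`). The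
relation `1 + e⁻ᶻ = (1 - e⁻²ᶻ)/(1 - e⁻ᶻ)` and `B_k(1-a) = (-1)^k B_k(a)` leave only even powers of
`ħ`. The involution `z ↦ -q/z` inverts `G_q`, which settles `G_q(-q ^ a)`, and `c_q = 2 / G_q(q)` is
the case `a = 1`, where `B_{2k+1}(1) = 0` kills every correction.

For nonreal `ω`, `G_q(ω q ^ a) = exp (Li₂(ω q ^ a; q) - Li₂(-ω⁻¹ q ^ (1-a); q))`. The two expansions
merge by inversion and duplication of polylogarithms, and by evaluating `Li₂(ω) - Li₂(-ω⁻¹)` on the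
circle through its derivative (`dilog_sub_dilog_neg_inv`). -/

theorem norm_sub_taylor_le {𝕜 E : Type*} [RCLike 𝕜] [NormedAddCommGroup E] [NormedSpace 𝕜 E]
    {F : ℕ → 𝕜 → E} {s : Set 𝕜} (hs : Convex ℝ s)
    (hF : ∀ k, ∀ z ∈ s, HasDerivWithinAt (F k) (F (k + 1) z) s z) {S : ℝ} {x : 𝕜} (hx : x ∈ s)
    (n : ℕ) : ∀ m : ℕ, (∀ z ∈ s, ‖F (m + n) z‖ ≤ S) → ∀ y ∈ s,
      ‖F m y - ∑ i ∈ Finset.range n, ((y - x) ^ i / (i.factorial : 𝕜)) • F (m + i) x‖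
        ≤ S * ‖y - x‖ ^ n := by
  induction n with
  | zero => intro m hS y hy; simpa using hS y hy
  | succ n ih =>
    intro m hS y hy
    have hS0 : 0 ≤ S := (norm_nonneg _).trans (hS x hx)
    have ih' := ih (m + 1) (fun z hz => by simpa [add_assoc, add_comm, add_left_comm] using hS z hz)
    -- On this smaller convex set the inductive bound for the derivative of the remainder is at most
    -- `S * ‖y - x‖ ^ n`, so the mean value inequality supplies the missing factor.
    set t : Set 𝕜 := s ∩ Metric.closedBall x ‖y - x‖ with ht
    have htc : Convex ℝ t := hs.inter (convex_closedBall x _)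
    have hd : ∀ z ∈ t, HasDerivWithinAt
        (fun y => F m y - ∑ i ∈ Finset.range (n + 1),
          ((y - x) ^ i / (i.factorial : 𝕜)) • F (m + i) x)
        (F (m + 1) z - ∑ i ∈ Finset.range n, ((z - x) ^ i / (i.factorial : 𝕜)) • F (m + 1 + i) x)
        t z := by
      intro z hz
      refine ((hF m z hz.1).mono Set.inter_subset_left).sub ?_
      have h1 : ∀ i ∈ Finset.range (n + 1), HasDerivWithinAt
          (fun y : 𝕜 => ((y - x) ^ i / (i.factorial : 𝕜)) • F (m + i) x)
          (((i : 𝕜) * (z - x) ^ (i - 1) * 1 / (i.factorial : 𝕜)) • F (m + i) x) t z := by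
        intro i _
        exact ((((hasDerivWithinAt_id z t).sub_const x).pow i).div_const _).smul_const _
      refine (HasDerivWithinAt.fun_sum h1).congr_deriv ?_
      rw [Finset.sum_range_succ']
      simp only [Nat.cast_zero, zero_mul, zero_div, zero_smul, add_zero]
      refine Finset.sum_congr rfl fun i _ => ?_
      rw [show m + 1 + i = m + (i + 1) by ring]
      congr 1
      rw [Nat.factorial_succ]
      push_cast
      have : (i : 𝕜) + 1 ≠ 0 := Nat.cast_add_one_ne_zero i
      rw [mul_one, mul_div_mul_left _ _ this]
    have hb : ∀ z ∈ t, ‖F (m + 1) z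
        - ∑ i ∈ Finset.range n, ((z - x) ^ i / (i.factorial : 𝕜)) • F (m + 1 + i) x‖
        ≤ S * ‖y - x‖ ^ n := by
      intro z hz
      refine (ih' z hz.1).trans ?_
      have : ‖z - x‖ ≤ ‖y - x‖ := by simpa [dist_eq_norm] using hz.2
      gcongr
    have hxt : x ∈ t := ⟨hx, by simp⟩
    have hyt : y ∈ t := ⟨hy, by simp [dist_eq_norm]⟩
    have key := htc.norm_image_sub_le_of_norm_hasDerivWithin_le hd hb hxt hyt
    have hx0 : F m x - ∑ i ∈ Finset.range (n + 1),
        ((x - x) ^ i / (i.factorial : 𝕜)) • F (m + i) x = 0 := by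
      rw [Finset.sum_range_succ']
      simp
    simp only [hx0, sub_zero] at key
    rw [pow_succ, ← mul_assoc]
    exact key

/-! ### Bernoulli polynomials at complex numbers -/

/-- The recursion `∑ C(n+1, k) B_k(a) = (n+1) a ^ n` divided by `(n+1)!`, the form in which it
cancels Taylor polynomials in `RayRegular.norm_step_le`. -/
theorem sum_bernoulliValue_div_factorial (a : ℂ) (n : ℕ) :
    ∑ k ∈ Finset.range (n + 1), bernoulliValue k a / (k.factorial : ℂ) / ((n - k + 1).factorial : ℂ)
      = a ^ n / (n.factorial : ℂ) := by
  have h := congrArg (Polynomial.aeval a) (Polynomial.sum_bernoulli n)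
  simp only [map_sum, Polynomial.aeval_monomial] at h
  have h2 : ∀ k ∈ Finset.range (n + 1),
      bernoulliValue k a / (k.factorial : ℂ) / ((n - k + 1).factorial : ℂ)
      = Polynomial.aeval a (((n + 1).choose k : ℚ) • Polynomial.bernoulli k)
          / ((n + 1).factorial : ℂ) := by
    intro k hk
    have hk' : k ≤ n + 1 := by have := Finset.mem_range.1 hk; omega
    have hk'' : k ≤ n := by have := Finset.mem_range.1 hk; omega
    rw [map_smul, Nat.cast_choose ℚ hk', show n + 1 - k = n - k + 1 by omega, bernoulliValue,
      Algebra.smul_def]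
    have h1 : ((n + 1).factorial : ℂ) ≠ 0 := by exact_mod_cast Nat.factorial_ne_zero _
    have h2 : ((n - k + 1).factorial : ℂ) ≠ 0 := by exact_mod_cast Nat.factorial_ne_zero _
    have h3 : (k.factorial : ℂ) ≠ 0 := by exact_mod_cast Nat.factorial_ne_zero _
    simp only [eq_ratCast]
    push_cast
    field_simp
  rw [Finset.sum_congr rfl h2, ← Finset.sum_div, h, Nat.factorial_succ]
  have h1 : (n.factorial : ℂ) ≠ 0 := by exact_mod_cast Nat.factorial_ne_zero _
  have h2 : (n : ℂ) + 1 ≠ 0 := Nat.cast_add_one_ne_zero n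
  simp only [map_add, map_natCast, map_one]
  push_cast
  field_simp

theorem continuous_bernoulliValue (k : ℕ) : Continuous (bernoulliValue k) :=
  Polynomial.continuous_aeval _

theorem exists_norm_bernoulliValue_le (k : ℕ) (A : ℝ) :
    ∃ b : ℝ, 0 ≤ b ∧ ∀ a : ℂ, ‖a‖ ≤ A → ‖bernoulliValue k a‖ ≤ b := by
  obtain ⟨b, hb⟩ := (isCompact_closedBall (0 : ℂ) A).exists_bound_of_continuousOn
    (continuous_bernoulliValue k).continuousOn
  exact ⟨max b 0, le_max_right _ _, fun a ha => (hb a (by simpa using ha)).trans (le_max_left _ _)⟩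

theorem bernoulliValue_one_sub (k : ℕ) (a : ℂ) :
    bernoulliValue k (1 - a) = (-1) ^ k * bernoulliValue k a := by
  have h := congrArg (Polynomial.aeval a) (Polynomial.bernoulli_comp_one_sub_X k)
  simpa [bernoulliValue, Polynomial.aeval_comp] using h

theorem bernoulliValue_one (a : ℂ) : bernoulliValue 1 a = a - 1 / 2 := by
  simp [bernoulliValue, Polynomial.bernoulli_one]

/-! ### Functions that are regular along the positive real axis -/

/-- `f` is holomorphic on the `2 ρ`-neighbourhood of `[0, ∞)`, where its first two derivatives
decay like `1 / x` and `1 / x ^ 2`. -/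
structure RayRegular (f : ℂ → ℂ) (ρ C : ℝ) : Prop where
  pos : 0 < ρ
  diff : ∀ x : ℝ, 0 ≤ x → DifferentiableOn ℂ f (Metric.ball (x : ℂ) (2 * ρ))
  norm_deriv_le : ∀ x : ℝ, 0 ≤ x → ∀ z ∈ Metric.ball (x : ℂ) (2 * ρ), ‖deriv f z‖ ≤ C / (1 + x)
  norm_deriv_deriv_le : ∀ x : ℝ, 0 ≤ x → ∀ z ∈ Metric.ball (x : ℂ) (2 * ρ),
    ‖deriv (deriv f) z‖ ≤ C / (1 + x) ^ 2

namespace RayRegular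

variable {f : ℂ → ℂ} {ρ C : ℝ}

theorem analyticAt_iteratedDeriv (hf : RayRegular f ρ C) (k : ℕ) {x : ℝ} (hx : 0 ≤ x) {z : ℂ}
    (hz : z ∈ Metric.ball (x : ℂ) (2 * ρ)) : AnalyticAt ℂ (iteratedDeriv k f) z := by
  rw [iteratedDeriv_eq_iterate]
  exact ((hf.diff x hx).analyticAt (Metric.isOpen_ball.mem_nhds hz)).iterated_deriv k

theorem hasDerivAt_iteratedDeriv (hf : RayRegular f ρ C) (k : ℕ) {x : ℝ} (hx : 0 ≤ x) {z : ℂ}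
    (hz : z ∈ Metric.ball (x : ℂ) (2 * ρ)) :
    HasDerivAt (iteratedDeriv k f) (iteratedDeriv (k + 1) f z) z := by
  rw [iteratedDeriv_succ]
  exact (hf.analyticAt_iteratedDeriv k hx hz).differentiableAt.hasDerivAt

theorem ofReal_mem_ball (hf : RayRegular f ρ C) (x : ℝ) : (x : ℂ) ∈ Metric.ball (x : ℂ) (2 * ρ) :=
  Metric.mem_ball_self (by linarith [hf.pos])

/-- Cauchy's estimate on circles of radius `ρ / 2` passes the decay of `f''` on to all higher
derivatives. The radius `2 ρ` in `RayRegular` leaves room for these circles. -/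
theorem exists_norm_iteratedDeriv_le (hf : RayRegular f ρ C) (k : ℕ) :
    ∃ B : ℝ, 0 ≤ B ∧ ∀ x : ℝ, 0 ≤ x → ∀ z ∈ Metric.ball (x : ℂ) ρ,
      ‖iteratedDeriv (k + 2) f z‖ ≤ B / (1 + x) ^ 2 := by
  have hρ := hf.pos
  have hC : 0 ≤ C := by
    have := (norm_nonneg _).trans (hf.norm_deriv_le 0 le_rfl _ (hf.ofReal_mem_ball 0))
    simpa using this
  refine ⟨k.factorial * C / (ρ / 2) ^ k, by positivity, fun x hx z hz => ?_⟩
  rw [iteratedDeriv_succ', iteratedDeriv_succ']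
  have hsub : Metric.closedBall z (ρ / 2) ⊆ Metric.ball (x : ℂ) (2 * ρ) := by
    intro w hw
    rw [Metric.mem_closedBall] at hw
    rw [Metric.mem_ball] at hz ⊢
    linarith [dist_triangle w z x]
  have hd : DifferentiableOn ℂ (deriv (deriv f)) (Metric.ball (x : ℂ) (2 * ρ)) :=
    ((hf.diff x hx).deriv Metric.isOpen_ball).deriv Metric.isOpen_ball
  have h := Complex.norm_iteratedDeriv_le_of_forall_mem_sphere_norm_le k (half_pos hρ)
    (hd.diffContOnCl_ball hsub)
    (fun w hw => hf.norm_deriv_deriv_le x hx w (hsub (Metric.sphere_subset_closedBall hw)))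
  refine h.trans (le_of_eq ?_)
  ring

theorem tendsto_iteratedDeriv (hf : RayRegular f ρ C) (k : ℕ) :
    Tendsto (fun x : ℝ => iteratedDeriv (k + 1) f (x : ℂ)) atTop (𝓝 0) := by
  have hlim : ∀ B : ℝ, Tendsto (fun x : ℝ => B / (1 + x)) atTop (𝓝 0) := fun B =>
    tendsto_const_nhds.div_atTop (tendsto_atTop_add_const_left _ _ tendsto_id)
  obtain ⟨B, hB⟩ : ∃ B : ℝ, ∀ x : ℝ, 0 ≤ x → ‖iteratedDeriv (k + 1) f (x : ℂ)‖ ≤ B / (1 + x) := by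
    cases k with
    | zero => exact ⟨C, fun x hx => by simpa using hf.norm_deriv_le x hx _ (hf.ofReal_mem_ball x)⟩
    | succ k =>
      obtain ⟨B, hB0, hB⟩ := hf.exists_norm_iteratedDeriv_le k
      refine ⟨B, fun x hx => (hB x hx _ (Metric.mem_ball_self hf.pos)).trans ?_⟩
      gcongr
      nlinarith
  exact squeeze_zero_norm' ((eventually_ge_atTop 0).mono hB) (hlim B)

/-- All derivatives are bounded on the ray. -/
theorem exists_norm_iteratedDeriv_ofReal_le (hf : RayRegular f ρ C) (k : ℕ) :
    ∃ B : ℝ, 0 ≤ B ∧ ∀ x : ℝ, 0 ≤ x → ‖iteratedDeriv (k + 1) f (x : ℂ)‖ ≤ B := by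
  have hC : 0 ≤ C := by
    have := (norm_nonneg _).trans (hf.norm_deriv_le 0 le_rfl _ (hf.ofReal_mem_ball 0))
    simpa using this
  cases k with
  | zero =>
    refine ⟨C, hC, fun x hx => ?_⟩
    have := hf.norm_deriv_le x hx _ (hf.ofReal_mem_ball x)
    simp only [zero_add, iteratedDeriv_one]
    exact this.trans (div_le_self hC (by linarith))
  | succ k =>
    obtain ⟨B, hB0, hB⟩ := hf.exists_norm_iteratedDeriv_le k
    refine ⟨B, hB0, fun x hx => (hB x hx _ (Metric.mem_ball_self hf.pos)).trans ?_⟩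
    exact div_le_self hB0 (by nlinarith)

end RayRegular

/-- The successive derivatives of `f` along the real axis, starting from a primitive. -/
noncomputable def rayDeriv (f : ℂ → ℂ) : ℕ → ℝ → ℂ
  | 0 => fun x => ∫ y in (0 : ℝ)..x, f y
  | k + 1 => fun x => iteratedDeriv k f (x : ℂ)

namespace RayRegular

variable {f : ℂ → ℂ} {ρ C : ℝ}

/-- Reaching slightly to the left of `0` makes the primitive of `f` differentiable from both sides
at the end point. -/
theorem continuousOn_ofReal (hf : RayRegular f ρ C) :
    ContinuousOn (fun y : ℝ => f y) (Set.Ioi (-ρ)) := by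
  intro y hy
  have hρ := hf.pos
  have hy : -ρ < y := hy
  have h : (y : ℂ) ∈ Metric.ball ((max y 0 : ℝ) : ℂ) (2 * ρ) := by
    rw [Metric.mem_ball, Complex.dist_eq, ← Complex.ofReal_sub, Complex.norm_real, Real.norm_eq_abs,
      abs_lt]
    constructor <;> rcases max_cases y 0 with ⟨h, _⟩ | ⟨h, _⟩ <;> rw [h] <;> linarith
  have := (hf.analyticAt_iteratedDeriv 0 (le_max_right y 0) h).continuousAt
  simp only [iteratedDeriv_zero] at this
  exact (ContinuousAt.comp (f := fun y : ℝ => (y : ℂ)) this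
    Complex.continuous_ofReal.continuousAt).continuousWithinAt

theorem hasDerivAt_rayDeriv (hf : RayRegular f ρ C) (k : ℕ) {x : ℝ} (hx : 0 ≤ x) :
    HasDerivAt (rayDeriv f k) (rayDeriv f (k + 1) x) x := by
  cases k with
  | zero =>
    have hρ := hf.pos
    have hc := hf.continuousOn_ofReal
    have hx' : x ∈ Set.Ioi (-ρ) := by simp; linarith
    simp only [rayDeriv, iteratedDeriv_zero]
    refine intervalIntegral.integral_hasDerivAt_right ?_ ?_ (hc.continuousAt (Ioi_mem_nhds hx'))
    · refine (hc.mono ?_).intervalIntegrable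
      rw [Set.uIcc_of_le hx]
      intro y hy
      have := hy.1
      simp only [Set.mem_Ioi]
      linarith
    · exact hc.stronglyMeasurableAtFilter isOpen_Ioi x hx'
  | succ k =>
    exact (hf.hasDerivAt_iteratedDeriv k hx (hf.ofReal_mem_ball x)).comp_ofReal

end RayRegular

/-! ### The Euler–Maclaurin formula with a complex shift -/

namespace RayRegular

variable {f : ℂ → ℂ} {ρ C : ℝ}

/-- One step of the Euler–Maclaurin formula. -/
theorem norm_step_le (hf : RayRegular f ρ C) {M : ℕ} {S A x t : ℝ}
    {b : ℕ → ℝ} (hx : 0 ≤ x) (ht : 0 < t) (htρ : t < ρ) (hAρ : A * t < ρ) (_hA : 0 ≤ A)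
    (hS : ∀ z ∈ Metric.ball (x : ℂ) ρ, ‖iteratedDeriv M f z‖ ≤ S) {a : ℂ} (ha : ‖a‖ ≤ A)
    (hb : ∀ k, ‖bernoulliValue k a‖ ≤ b k) :
    ‖(t : ℂ) * f (x + a * t) - ∑ k ∈ Finset.range (M + 1),
        bernoulliValue k a / (k.factorial : ℂ) * (t : ℂ) ^ k
          * (rayDeriv f k (x + t) - rayDeriv f k x)‖
      ≤ (A ^ M + ∑ k ∈ Finset.range (M + 1), b k) * S * t ^ (M + 1) := by
  have hρ := hf.pos
  have hS0 : 0 ≤ S := (norm_nonneg _).trans (hS x (Metric.mem_ball_self hρ))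
  -- `G 0` is a primitive of `f` and `B_0(a) = 1`, so the term `k = 0` is the integral of `f` over
  -- the step. Both sides are expanded at `x`: the value in a complex ball, the increments along the
  -- real axis.
  set G := rayDeriv f with hG
  -- expansion of the value
  have hval : ‖f (x + a * t) - ∑ i ∈ Finset.range M, (a * t) ^ i / (i.factorial : ℂ) * G (i + 1) x‖
      ≤ S * (A * t) ^ M := by
    have hmem : (x : ℂ) + a * t ∈ Metric.ball (x : ℂ) ρ := by
      rw [mem_ball_iff_norm, add_sub_cancel_left, norm_mul, Complex.norm_real, Real.norm_eq_abs,
        abs_of_pos ht]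
      exact (mul_le_mul_of_nonneg_right ha ht.le).trans_lt hAρ
    have h := norm_sub_taylor_le (F := fun k => iteratedDeriv k f) (convex_ball (x : ℂ) ρ)
      (fun k z hz => (hf.hasDerivAt_iteratedDeriv k hx
        (Metric.ball_subset_ball (by linarith) hz)).hasDerivWithinAt)
      (Metric.mem_ball_self hρ) M 0 (by simpa using hS) _ hmem
    simp only [iteratedDeriv_zero, add_sub_cancel_left, smul_eq_mul, zero_add] at h
    refine h.trans ?_
    rw [norm_mul, Complex.norm_real, Real.norm_eq_abs, abs_of_pos ht]
    gcongr
  -- expansion of the increments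
  have hinc : ∀ k ∈ Finset.range (M + 1), ‖G k (x + t) - G k x
      - ∑ i ∈ Finset.range (M - k), (t : ℂ) ^ (i + 1) / ((i + 1).factorial : ℂ) * G (k + (i + 1)) x‖
      ≤ S * t ^ (M - k + 1) := by
    intro k hk
    have hk : k ≤ M := by have := Finset.mem_range.1 hk; omega
    have h := norm_sub_taylor_le (F := G) (convex_Icc x (x + t))
      (fun k z hz => (hf.hasDerivAt_rayDeriv k (hx.trans hz.1)).hasDerivWithinAt)
      (Set.left_mem_Icc.2 (by linarith)) (S := S) (M - k + 1) k (by
        intro z hz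
        rw [show k + (M - k + 1) = M + 1 by omega]
        refine hS _ ?_
        rw [mem_ball_iff_norm, ← Complex.ofReal_sub, Complex.norm_real, Real.norm_eq_abs, abs_lt]
        constructor <;> linarith [hz.1, hz.2]) (x + t) (Set.right_mem_Icc.2 (by linarith))
    rw [Finset.sum_range_succ', add_sub_cancel_left, Real.norm_eq_abs, abs_of_pos ht] at h
    refine le_of_eq_of_le (congrArg norm ?_) h
    have h0 : ∀ i, ((t ^ i / (i.factorial : ℝ) : ℝ) • G (k + i) x)
        = (t : ℂ) ^ i / (i.factorial : ℂ) * G (k + i) x := by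
      intro i
      rw [Complex.real_smul]
      push_cast
      rfl
    rw [Finset.sum_congr rfl fun i _ => h0 (i + 1), h0 0]
    simp only [pow_zero, Nat.factorial_zero, Nat.cast_one, div_one, one_mul, add_zero]
    ring
  -- the Taylor polynomials cancel
  have hcancel : (t : ℂ) * ∑ i ∈ Finset.range M, (a * t) ^ i / (i.factorial : ℂ) * G (i + 1) x
      = ∑ k ∈ Finset.range (M + 1), bernoulliValue k a / (k.factorial : ℂ) * (t : ℂ) ^ k *
        ∑ i ∈ Finset.range (M - k), (t : ℂ) ^ (i + 1) / ((i + 1).factorial : ℂ)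
            * G (k + (i + 1)) x := by
    rw [Finset.sum_range_succ, Nat.sub_self, Finset.range_zero, Finset.sum_empty, mul_zero,
      add_zero]
    simp only [Finset.mul_sum]
    -- Grouping the double sum by `n = k + i`, the coefficient of `G (n + 1) x` becomes the
    -- Bernoulli recursion.
    rw [← Finset.sum_range_diag_flip M fun k i => bernoulliValue k a / (k.factorial : ℂ)
      * (t : ℂ) ^ k * ((t : ℂ) ^ (i + 1) / ((i + 1).factorial : ℂ) * G (k + (i + 1)) x)]
    refine Finset.sum_congr rfl fun n _ => ?_
    rw [mul_pow, mul_div_right_comm, ← sum_bernoulliValue_div_factorial, Finset.sum_mul,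
      Finset.sum_mul, Finset.mul_sum]
    refine Finset.sum_congr rfl fun k hk => ?_
    have hk : k ≤ n := by have := Finset.mem_range.1 hk; omega
    rw [show k + (n - k + 1) = n + 1 by omega]
    have : (t : ℂ) ^ n = (t : ℂ) ^ k * (t : ℂ) ^ (n - k) := by rw [← pow_add]; congr 1; omega
    rw [this]
    ring
  have hsplit : (t : ℂ) * f (x + a * t) - ∑ k ∈ Finset.range (M + 1),
        bernoulliValue k a / (k.factorial : ℂ) * (t : ℂ) ^ k * (G k (x + t) - G k x)
      = (t : ℂ) * (f (x + a * t)
          - ∑ i ∈ Finset.range M, (a * t) ^ i / (i.factorial : ℂ) * G (i + 1) x)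
        - ∑ k ∈ Finset.range (M + 1), bernoulliValue k a / (k.factorial : ℂ) * (t : ℂ) ^ k *
          (G k (x + t) - G k x - ∑ i ∈ Finset.range (M - k),
            (t : ℂ) ^ (i + 1) / ((i + 1).factorial : ℂ) * G (k + (i + 1)) x) := by
    rw [mul_sub, hcancel]
    simp only [mul_sub, Finset.sum_sub_distrib]
    ring
  rw [hsplit]
  have e1 : ‖(t : ℂ) * (f (x + a * t)
          - ∑ i ∈ Finset.range M, (a * t) ^ i / (i.factorial : ℂ) * G (i + 1) x)‖
      ≤ A ^ M * S * t ^ (M + 1) := by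
    rw [norm_mul, Complex.norm_real, Real.norm_eq_abs, abs_of_pos ht]
    calc t * _ ≤ t * (S * (A * t) ^ M) := by gcongr
      _ = _ := by rw [mul_pow]; ring
  have e2 : ‖∑ k ∈ Finset.range (M + 1), bernoulliValue k a / (k.factorial : ℂ) * (t : ℂ) ^ k *
          (G k (x + t) - G k x - ∑ i ∈ Finset.range (M - k),
            (t : ℂ) ^ (i + 1) / ((i + 1).factorial : ℂ) * G (k + (i + 1)) x)‖
      ≤ (∑ k ∈ Finset.range (M + 1), b k) * S * t ^ (M + 1) := by
    rw [Finset.sum_mul, Finset.sum_mul]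
    refine norm_sum_le_of_le _ fun k hk => ?_
    have hk' : k ≤ M := by have := Finset.mem_range.1 hk; omega
    rw [norm_mul, norm_mul, norm_div, norm_pow, Complex.norm_real, Real.norm_eq_abs, abs_of_pos ht,
      Complex.norm_natCast]
    have hb0 : 0 ≤ b k := (norm_nonneg _).trans (hb k)
    have h1 : ‖bernoulliValue k a‖ / (k.factorial : ℝ) ≤ b k :=
      (div_le_self (norm_nonneg _) (Nat.one_le_cast.2 (Nat.factorial_pos k))).trans (hb k)
    calc _ ≤ b k * t ^ k * (S * t ^ (M - k + 1)) := by
          gcongr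
          exact hinc k hk
      _ = b k * S * (t ^ k * t ^ (M - k + 1)) := by ring
      _ = _ := by rw [← pow_add]; congr 2; omega
  calc _ ≤ A ^ M * S * t ^ (M + 1) + (∑ k ∈ Finset.range (M + 1), b k) * S * t ^ (M + 1) :=
        (norm_sub_le _ _).trans (add_le_add e1 e2)
    _ = _ := by ring

end RayRegular

/-- Comparison with a telescoping sum. Adding up the step errors thus costs one factor `1 / t`,
whatever the number of steps. -/
theorem sum_inv_one_add_mul_sq_le {t : ℝ} (ht : 0 < t) (ht1 : t ≤ 1) (N : ℕ) :
    ∑ j ∈ Finset.range N, 1 / (1 + (j : ℝ) * t) ^ 2 ≤ 2 / t := by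
  have h : ∀ N : ℕ, ∑ j ∈ Finset.range N, 1 / (1 + (j : ℝ) * t) ^ 2
      ≤ 2 / t - 2 / (t * (1 + N * t)) := by
    intro N
    induction N with
    | zero => simp
    | succ N ih =>
      rw [Finset.sum_range_succ]
      have hN : 0 ≤ (N : ℝ) * t := by positivity
      have h1 : 1 / (1 + (N : ℝ) * t) ^ 2 ≤ 2 / ((1 + N * t) * (1 + N * t + t)) := by
        rw [div_le_div_iff₀ (by positivity) (by positivity)]
        nlinarith
      have h2 : 2 / (t * (1 + N * t)) - 2 / (t * (1 + N * t + t))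
          = 2 / ((1 + N * t) * (1 + N * t + t)) := by
        have : 1 + N * t + t ≠ 0 := by positivity
        field_simp
        ring
      rw [show 1 + ((N + 1 : ℕ) : ℝ) * t = 1 + N * t + t by push_cast; ring]
      linarith
  refine (h N).trans (sub_le_self _ (by positivity))

namespace RayRegular

variable {f : ℂ → ℂ} {ρ C : ℝ}

/-- The Euler–Maclaurin formula, uniformly in the shift and in the number of terms. -/
theorem euler_maclaurin (hf : RayRegular f ρ C) {M : ℕ} (hM : 1 ≤ M) (A : ℝ) :
    ∃ B δ : ℝ, 0 ≤ B ∧ 0 < δ ∧ ∀ t : ℝ, 0 < t → t < δ → ∀ a : ℂ, ‖a‖ ≤ A → ∀ N : ℕ,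
      ‖∑ j ∈ Finset.range N, f ((a + j) * t)
        - ((t : ℂ)⁻¹ * (∫ y in (0 : ℝ)..(N * t), f y) + ∑ k ∈ Finset.Icc 1 M,
            bernoulliValue k a / (k.factorial : ℂ) * (t : ℂ) ^ (k - 1)
              * (iteratedDeriv (k - 1) f ((N * t : ℝ) : ℂ) - iteratedDeriv (k - 1) f 0))‖
        ≤ B * t ^ M := by
  have hρ := hf.pos
  obtain ⟨M, rfl⟩ : ∃ n, M = n + 1 := ⟨M - 1, by omega⟩
  -- The wanted order is now `M + 1`. The step estimate is used at order `M + 2`, with error `t ^ (M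
  -- + 3)`: summation over `j` loses one power and division by `t` another. The surplus boundary
  -- term `k = M + 2` goes into the error by means of `T`.
  obtain ⟨S, hS0, hS⟩ := hf.exists_norm_iteratedDeriv_le M
  obtain ⟨T, hT0, hT⟩ := hf.exists_norm_iteratedDeriv_ofReal_le M
  choose b hb0 hb using fun k => exists_norm_bernoulliValue_le k (max A 0)
  set A' := max A 0
  have hA0 : 0 ≤ A' := le_max_right _ _
  set B₁ := A' ^ (M + 2) + ∑ k ∈ Finset.range (M + 2 + 1), b k with hB₁
  have hB₁0 : 0 ≤ B₁ := by
    have := Finset.sum_nonneg fun k (_ : k ∈ Finset.range (M + 2 + 1)) => hb0 k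
    positivity
  -- `t < 1` serves the comparison sum; `(A' + 1) * t < ρ` gives both `t < ρ` and `A' * t < ρ`.
  refine ⟨2 * B₁ * S + b (M + 2) * (2 * T), min 1 (ρ / (A' + 1)),
    by have := hb0 (M + 2); positivity, by positivity, ?_⟩
  intro t ht htδ a ha N
  have ht1 : t < 1 := htδ.trans_le (min_le_left _ _)
  have ht2 : (A' + 1) * t < ρ := by
    have := htδ.trans_le (min_le_right _ _)
    rwa [lt_div_iff₀ (by positivity), mul_comm] at this
  have htc : (t : ℂ) ≠ 0 := by exact_mod_cast ht.ne'
  have ha' : ‖a‖ ≤ A' := ha.trans (le_max_left _ _)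
  have hstep : ∀ j ∈ Finset.range N, ‖(t : ℂ) * f ((a + j) * t)
        - ∑ k ∈ Finset.range (M + 2 + 1), bernoulliValue k a / (k.factorial : ℂ) * (t : ℂ) ^ k
          * (rayDeriv f k (((j + 1 : ℕ) : ℝ) * t) - rayDeriv f k ((j : ℝ) * t))‖
      ≤ B₁ * S * t ^ (M + 3) * (1 / (1 + (j : ℝ) * t) ^ 2) := by
    intro j _
    have hx : 0 ≤ (j : ℝ) * t := by positivity
    have := hf.norm_step_le (M := M + 2) (b := b) hx ht (by nlinarith) (by nlinarith)
      hA0 (hS _ hx) ha' (fun k => hb k a ha')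
    rw [show ((j + 1 : ℕ) : ℝ) * t = j * t + t by push_cast; ring,
      show (a + j) * (t : ℂ) = ((j * t : ℝ) : ℂ) + a * t by push_cast; ring]
    refine this.trans (le_of_eq ?_)
    ring
  have hsum := norm_sum_le_of_le _ hstep
  rw [← Finset.mul_sum, Finset.sum_sub_distrib, ← Finset.mul_sum, Finset.sum_comm] at hsum
  simp only [← Finset.mul_sum] at hsum
  have htel : ∀ k, ∑ j ∈ Finset.range N,
      (rayDeriv f k (((j + 1 : ℕ) : ℝ) * t) - rayDeriv f k ((j : ℝ) * t))
      = rayDeriv f k (N * t) - rayDeriv f k 0 := by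
    intro k
    rw [Finset.sum_range_sub fun j : ℕ => rayDeriv f k ((j : ℝ) * t)]
    simp
  simp only [htel] at hsum
  have hsum2 : ‖(t : ℂ) * ∑ j ∈ Finset.range N, f ((a + j) * t)
        - ∑ k ∈ Finset.range (M + 2 + 1), bernoulliValue k a / (k.factorial : ℂ) * (t : ℂ) ^ k
          * (rayDeriv f k (N * t) - rayDeriv f k 0)‖ ≤ t * (2 * B₁ * S * t ^ (M + 1)) := by
    refine hsum.trans ?_
    calc _ ≤ B₁ * S * t ^ (M + 3) * (2 / t) := by
          gcongr
          exact sum_inv_one_add_mul_sq_le ht ht1.le N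
      _ = _ := by field_simp; ring
  have hmain : (t : ℂ) * (∑ j ∈ Finset.range N, f ((a + j) * t)
        - ((t : ℂ)⁻¹ * (∫ y in (0 : ℝ)..(N * t), f y) + ∑ k ∈ Finset.Icc 1 (M + 1),
            bernoulliValue k a / (k.factorial : ℂ) * (t : ℂ) ^ (k - 1)
              * (iteratedDeriv (k - 1) f ((N * t : ℝ) : ℂ) - iteratedDeriv (k - 1) f 0)))
      = ((t : ℂ) * ∑ j ∈ Finset.range N, f ((a + j) * t)
        - ∑ k ∈ Finset.range (M + 2 + 1), bernoulliValue k a / (k.factorial : ℂ) * (t : ℂ) ^ k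
          * (rayDeriv f k (N * t) - rayDeriv f k 0))
        + bernoulliValue (M + 2) a / ((M + 2).factorial : ℂ) * (t : ℂ) ^ (M + 2)
          * (iteratedDeriv (M + 1) f ((N * t : ℝ) : ℂ)
            - iteratedDeriv (M + 1) f ((0 : ℝ) : ℂ)) := by
    rw [Finset.sum_range_succ _ (M + 2), Finset.sum_range_succ' _ (M + 1)]
    rw [show Finset.Icc 1 (M + 1) = Finset.Ico 1 (M + 2) from rfl,
      Finset.sum_Ico_eq_sum_range, show M + 2 - 1 = M + 1 by omega]
    simp only [rayDeriv, bernoulliValue, Polynomial.bernoulli_zero, map_one, Nat.factorial_zero,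
      Nat.cast_one, pow_zero, div_one, one_mul, intervalIntegral.integral_same, sub_zero,
      Complex.ofReal_zero, mul_sub, mul_add, mul_inv_cancel_left₀ htc, Finset.mul_sum,
      Finset.sum_sub_distrib, Nat.add_sub_cancel_left]
    have hre : ∀ (c : ℕ → ℂ), ∑ k ∈ Finset.range (M + 1), (t : ℂ) *
        (bernoulliValue (1 + k) a / ((1 + k).factorial : ℂ) * (t : ℂ) ^ k * c k)
        = ∑ k ∈ Finset.range (M + 1),
          bernoulliValue (k + 1) a / ((k + 1).factorial : ℂ) * (t : ℂ) ^ (k + 1) * c k := by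
      intro c
      refine Finset.sum_congr rfl fun k _ => ?_
      rw [add_comm 1 k]
      ring
    simp only [bernoulliValue] at hre
    rw [hre, hre fun k => iteratedDeriv k f 0]
    ring
  have hfin : t * ‖∑ j ∈ Finset.range N, f ((a + j) * t)
        - ((t : ℂ)⁻¹ * (∫ y in (0 : ℝ)..(N * t), f y) + ∑ k ∈ Finset.Icc 1 (M + 1),
            bernoulliValue k a / (k.factorial : ℂ) * (t : ℂ) ^ (k - 1)
              * (iteratedDeriv (k - 1) f ((N * t : ℝ) : ℂ) - iteratedDeriv (k - 1) f 0))‖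
      ≤ t * ((2 * B₁ * S + b (M + 2) * (2 * T)) * t ^ (M + 1)) := by
    have h1 : ∀ z : ℂ, t * ‖z‖ = ‖(t : ℂ) * z‖ := fun z => by
      rw [norm_mul, Complex.norm_real, Real.norm_eq_abs, abs_of_pos ht]
    rw [h1, hmain]
    refine (norm_add_le_of_le hsum2 (r₂ := b (M + 2) * t ^ (M + 2) * (2 * T)) ?_).trans
      (le_of_eq (by ring))
    rw [norm_mul, norm_mul, norm_div, norm_pow, Complex.norm_real, Real.norm_eq_abs, abs_of_pos ht,
      Complex.norm_natCast]
    have hb0 := hb0 (M + 2)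
    have h1 : ‖bernoulliValue (M + 2) a‖ / ((M + 2).factorial : ℝ) ≤ b (M + 2) :=
      (div_le_self (norm_nonneg _) (Nat.one_le_cast.2 (Nat.factorial_pos _))).trans (hb _ a ha')
    gcongr
    refine (norm_sub_le _ _).trans ?_
    linarith [hT (N * t) (by positivity), hT 0 le_rfl]
  exact le_of_mul_le_mul_left hfin ht

end RayRegular

/-! ### A criterion for regularity along the ray -/

/-- The `σ`-neighbourhood (in the sup norm) of the positive real axis. -/
def rayStrip (σ : ℝ) : Set ℂ := {z | -σ < z.re ∧ |z.im| < σ}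

theorem isOpen_rayStrip (σ : ℝ) : IsOpen (rayStrip σ) :=
  (isOpen_lt continuous_const Complex.continuous_re).inter
    (isOpen_lt (continuous_abs.comp Complex.continuous_im) continuous_const)

theorem ofReal_mem_rayStrip {σ x : ℝ} (hσ : 0 < σ) (hx : 0 ≤ x) : (x : ℂ) ∈ rayStrip σ := by
  simp only [rayStrip, Set.mem_ofPred_eq, Complex.ofReal_re, Complex.ofReal_im, abs_zero]
  exact ⟨by linarith, hσ⟩

/-- Decay matters only for `Re z ≥ 1`: the rest of the `σ / 2`-neighbourhood of the ray lies in the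
compact rectangle `K`, where the derivatives are bounded by continuity. -/
theorem exists_rayRegular {f : ℂ → ℂ} {σ C : ℝ} (hσ0 : 0 < σ) (hσ1 : σ ≤ 1)
    (hf : DifferentiableOn ℂ f (rayStrip σ))
    (h1 : ∀ z ∈ rayStrip σ, 1 ≤ z.re → ‖deriv f z‖ ≤ C / z.re)
    (h2 : ∀ z ∈ rayStrip σ, 1 ≤ z.re → ‖deriv (deriv f) z‖ ≤ C / z.re ^ 2) :
    ∃ C' : ℝ, RayRegular f (σ / 4) C' := by
  have ho := isOpen_rayStrip σ
  set K : Set ℂ := Set.Icc (-(σ / 2)) 1 ×ℂ Set.Icc (-(σ / 2)) (σ / 2) with hK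
  have hKc : IsCompact K := isCompact_Icc.reProdIm isCompact_Icc
  have hKs : K ⊆ rayStrip σ := by
    intro z hz
    obtain ⟨⟨h1, _⟩, h3, h4⟩ := Complex.mem_reProdIm.1 hz
    exact ⟨by linarith, abs_lt.2 ⟨by linarith, by linarith⟩⟩
  obtain ⟨B₁, hB₁⟩ := hKc.exists_bound_of_continuousOn ((hf.deriv ho).continuousOn.mono hKs)
  obtain ⟨B₂, hB₂⟩ := hKc.exists_bound_of_continuousOn
    (((hf.deriv ho).deriv ho).continuousOn.mono hKs)
  have key : ∀ x : ℝ, 0 ≤ x → ∀ z ∈ Metric.ball (x : ℂ) (2 * (σ / 4)),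
      |z.re - x| < σ / 2 ∧ |z.im| < σ / 2 := by
    intro x _ z hz
    rw [mem_ball_iff_norm] at hz
    have h1 := (Complex.abs_re_le_norm (z - x)).trans_lt hz
    have h2 := (Complex.abs_im_le_norm (z - x)).trans_lt hz
    simp only [Complex.sub_re, Complex.ofReal_re, Complex.sub_im, Complex.ofReal_im, sub_zero]
      at h1 h2
    exact ⟨by linarith, by linarith⟩
  have hsub : ∀ x : ℝ, 0 ≤ x → Metric.ball (x : ℂ) (2 * (σ / 4)) ⊆ rayStrip σ := by
    intro x hx z hz
    obtain ⟨h1, h2⟩ := key x hx z hz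
    exact ⟨by linarith [(abs_lt.1 h1).1], by linarith⟩
  have hdich : ∀ x : ℝ, 0 ≤ x → ∀ z ∈ Metric.ball (x : ℂ) (2 * (σ / 4)),
      (1 ≤ z.re ∧ 1 + x ≤ 3 * z.re) ∨ (z ∈ K ∧ 1 + x ≤ 3) := by
    intro x hx z hz
    obtain ⟨h1, h2⟩ := key x hx z hz
    rw [abs_lt] at h1 h2
    by_cases h : 1 ≤ z.re
    · exact Or.inl ⟨h, by linarith⟩
    · refine Or.inr ⟨Complex.mem_reProdIm.2 ⟨⟨by linarith, by linarith⟩, ?_, ?_⟩, ?_⟩ <;> linarith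
  -- The factor `9 = 3 ^ 2` comes from `1 + x ≤ 3 * z.re` far out and `1 + x ≤ 3` on `K`, squared
  -- for the second derivative.
  refine ⟨9 * (|C| + |B₁| + |B₂|), by positivity, fun x hx => hf.mono (hsub x hx), ?_, ?_⟩
  · intro x hx z hz
    have hx1 : 0 < 1 + x := by positivity
    rcases hdich x hx z hz with ⟨hz1, hz2⟩ | ⟨hz1, hz2⟩
    · refine (h1 z (hsub x hx hz) hz1).trans ?_
      rw [div_le_div_iff₀ (by positivity) hx1]
      have := le_abs_self C
      nlinarith [abs_nonneg C, abs_nonneg B₁, abs_nonneg B₂]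
    · refine (hB₁ z hz1).trans ?_
      rw [le_div_iff₀ hx1]
      have := le_abs_self B₁
      nlinarith [abs_nonneg C, abs_nonneg B₁, abs_nonneg B₂]
  · intro x hx z hz
    have hx1 : 0 < 1 + x := by positivity
    rcases hdich x hx z hz with ⟨hz1, hz2⟩ | ⟨hz1, hz2⟩
    · refine (h2 z (hsub x hx hz) hz1).trans ?_
      rw [div_le_div_iff₀ (by positivity) (by positivity)]
      have h3 := le_abs_self C
      have h4 : (1 + x) ^ 2 ≤ 9 * z.re ^ 2 := by nlinarith
      calc C * (1 + x) ^ 2 ≤ |C| * (9 * z.re ^ 2) := by gcongr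
        _ = 9 * |C| * z.re ^ 2 := by ring
        _ ≤ _ := by gcongr; linarith [abs_nonneg B₁, abs_nonneg B₂]
    · refine (hB₂ z hz1).trans ?_
      rw [le_div_iff₀ (by positivity)]
      have h3 := le_abs_self B₂
      have h4 : (1 + x) ^ 2 ≤ 9 := by nlinarith
      calc B₂ * (1 + x) ^ 2 ≤ |B₂| * 9 := by gcongr
        _ ≤ _ := by linarith [abs_nonneg B₁, abs_nonneg C]

/-! ### The functions `log (1 - ω e⁻ˣ)` and `log ((1 - e⁻ˣ) / x)` -/

/-- `Li₀(ω e⁻ᶻ)`. -/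
noncomputable def expGeom (ω z : ℂ) : ℂ := ω * Complex.exp (-z) / (1 - ω * Complex.exp (-z))

/-- `log (1 - ω e⁻ᶻ)`. -/
noncomputable def logOneSubExp (ω z : ℂ) : ℂ := Complex.log (1 - ω * Complex.exp (-z))

theorem hasDerivAt_one_sub_exp (ω z : ℂ) :
    HasDerivAt (fun z : ℂ => 1 - ω * Complex.exp (-z)) (ω * Complex.exp (-z)) z := by
  refine ((((hasDerivAt_neg z).cexp).const_mul ω).const_sub 1).congr_deriv ?_
  ring

theorem hasDerivAt_logOneSubExp {ω z : ℂ} (h : 1 - ω * Complex.exp (-z) ∈ Complex.slitPlane) :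
    HasDerivAt (logOneSubExp ω) (expGeom ω z) z :=
  (hasDerivAt_one_sub_exp ω z).clog h

theorem hasDerivAt_expGeom {ω z : ℂ} (h : 1 - ω * Complex.exp (-z) ≠ 0) :
    HasDerivAt (expGeom ω)
      (-(ω * Complex.exp (-z)) / (1 - ω * Complex.exp (-z)) ^ 2) z := by
  have h1 : HasDerivAt (fun z : ℂ => ω * Complex.exp (-z)) (-(ω * Complex.exp (-z))) z := by
    refine (((hasDerivAt_neg z).cexp).const_mul ω).congr_deriv ?_
    ring
  refine (h1.div (hasDerivAt_one_sub_exp ω z) h).congr_deriv ?_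
  congr 1
  ring

theorem norm_mul_exp_neg {ω : ℂ} (hω : ‖ω‖ = 1) (z : ℂ) :
    ‖ω * Complex.exp (-z)‖ = Real.exp (-z.re) := by
  rw [norm_mul, hω, one_mul, Complex.norm_exp, Complex.neg_re]

theorem half_le_norm_one_sub {ω z : ℂ} (hω : ‖ω‖ = 1) (hz : 1 ≤ z.re) :
    1 / 2 ≤ ‖1 - ω * Complex.exp (-z)‖ := by
  have h1 := norm_sub_norm_le (1 : ℂ) (ω * Complex.exp (-z))
  rw [norm_mul_exp_neg hω, norm_one] at h1
  have h2 : Real.exp (-z.re) ≤ 1 / 2 := by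
    rw [Real.exp_neg, one_div]
    gcongr
    linarith [Real.add_one_le_exp z.re]
  linarith

theorem norm_expGeom_le {ω z : ℂ} (hω : ‖ω‖ = 1) (hz : 1 ≤ z.re) :
    ‖expGeom ω z‖ ≤ 2 / z.re := by
  have h0 := half_le_norm_one_sub hω hz
  rw [expGeom, norm_div, norm_mul_exp_neg hω, div_le_div_iff₀ (by linarith) (by linarith),
    Real.exp_neg]
  have h2 : z.re ≤ Real.exp z.re := by linarith [Real.add_one_le_exp z.re]
  calc (Real.exp z.re)⁻¹ * z.re ≤ (Real.exp z.re)⁻¹ * Real.exp z.re := by gcongr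
    _ = 1 := inv_mul_cancel₀ (Real.exp_pos _).ne'
    _ ≤ _ := by linarith

theorem norm_deriv_expGeom_le {ω z : ℂ} (hω : ‖ω‖ = 1) (hz : 1 ≤ z.re) :
    ‖-(ω * Complex.exp (-z)) / (1 - ω * Complex.exp (-z)) ^ 2‖ ≤ 8 / z.re ^ 2 := by
  have h0 := half_le_norm_one_sub hω hz
  rw [norm_div, norm_neg, norm_mul_exp_neg hω, norm_pow,
    div_le_div_iff₀ (by positivity) (by positivity), Real.exp_neg]
  have h2 : z.re ^ 2 ≤ 2 * Real.exp z.re := by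
    linarith [Real.quadratic_le_exp_of_nonneg (by linarith : 0 ≤ z.re)]
  calc (Real.exp z.re)⁻¹ * z.re ^ 2 ≤ (Real.exp z.re)⁻¹ * (2 * Real.exp z.re) := by gcongr
    _ = 2 := by field_simp
    _ ≤ _ := by nlinarith

/-- A width of a strip around `[0, ∞)` on which `1 - ω e⁻ᶻ` avoids the branch cut. -/
theorem exists_strip_mem_slitPlane {ω : ℂ} (hω : ‖ω‖ = 1) (hω1 : ω ≠ 1) :
    ∃ σ : ℝ, 0 < σ ∧ σ ≤ 1 ∧
      ∀ z ∈ rayStrip σ, 1 - ω * Complex.exp (-z) ∈ Complex.slitPlane := by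
  have harg : ω.arg ≠ 0 := by
    intro h
    apply hω1
    rw [← Complex.norm_mul_exp_arg_mul_I ω, h, hω]
    simp
  refine ⟨min 1 |ω.arg|, lt_min one_pos (abs_pos.2 harg), min_le_left _ _, fun z hz => ?_⟩
  -- On the cut, `ω e⁻ᶻ` is a real number `≥ 1`, so `ω` is a positive multiple of `e^{i Im z}` and
  -- `arg ω = Im z`; but `|Im z| < |arg ω|`.
  by_contra hns
  rw [Complex.mem_slitPlane_iff, not_or, not_lt, not_not] at hns
  obtain ⟨hre, him⟩ := hns
  set u := ω * Complex.exp (-z) with hu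
  simp only [Complex.sub_re, Complex.one_re, Complex.sub_im, Complex.one_im] at hre him
  have hur : u = (u.re : ℂ) := Complex.ext (by simp) (by simp; linarith)
  have hω' : ω =
      ((u.re * Real.exp z.re : ℝ) : ℂ) * (Complex.cos z.im + Complex.sin z.im * Complex.I) := by
    rw [← Complex.exp_mul_I, Complex.ofReal_mul, ← hur, Complex.ofReal_exp, mul_assoc,
      ← Complex.exp_add, Complex.re_add_im, hu, mul_assoc, ← Complex.exp_add]
    simp
  have hpos : 0 < u.re * Real.exp z.re := mul_pos (by linarith) (Real.exp_pos _)
  have hlt := hz.2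
  have h1 : |z.im| < 1 := hlt.trans_le (min_le_left _ _)
  have h2 : |z.im| < |ω.arg| := hlt.trans_le (min_le_right _ _)
  have h3 : ω.arg = z.im := by
    rw [hω', Complex.arg_real_mul _ hpos, Complex.arg_cos_add_sin_mul_I]
    rw [abs_lt] at h1
    exact ⟨by linarith [Real.pi_gt_three], by linarith [Real.pi_gt_three]⟩
  rw [h3] at h2
  exact lt_irrefl _ h2

theorem exists_rayRegular_logOneSubExp {ω : ℂ} (hω : ‖ω‖ = 1) (hω1 : ω ≠ 1) :
    ∃ ρ C : ℝ, RayRegular (logOneSubExp ω) ρ C := by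
  obtain ⟨σ, hσ0, hσ1, hs⟩ := exists_strip_mem_slitPlane hω hω1
  have hd : ∀ z ∈ rayStrip σ, deriv (logOneSubExp ω) z = expGeom ω z := fun z hz =>
    (hasDerivAt_logOneSubExp (hs z hz)).deriv
  refine ⟨_, exists_rayRegular (C := 8) hσ0 hσ1
    (fun z hz => (hasDerivAt_logOneSubExp (hs z hz)).differentiableAt.differentiableWithinAt)
    (fun z hz hz1 => ?_) (fun z hz hz1 => ?_)⟩
  · rw [hd z hz]
    refine (norm_expGeom_le hω hz1).trans ?_
    gcongr
    norm_num
  · have he : deriv (logOneSubExp ω) =ᶠ[𝓝 z] expGeom ω :=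
      Filter.eventually_of_mem ((isOpen_rayStrip σ).mem_nhds hz) hd
    rw [he.deriv_eq, (hasDerivAt_expGeom (Complex.slitPlane_ne_zero (hs z hz))).deriv]
    exact norm_deriv_expGeom_le hω hz1

/-- `(1 - e⁻ᶻ) / z`, with the removable singularity filled in. -/
noncomputable def expQuot : ℂ → ℂ := dslope (fun z => 1 - Complex.exp (-z)) 0

/-- `log ((1 - e⁻ᶻ) / z)`. -/
noncomputable def logExpQuot (z : ℂ) : ℂ := Complex.log (expQuot z)

theorem expQuot_of_ne {z : ℂ} (hz : z ≠ 0) : expQuot z = (1 - Complex.exp (-z)) / z := by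
  rw [expQuot, dslope_of_ne _ hz, slope_def_field]
  simp

theorem expQuot_zero : expQuot 0 = 1 := by
  rw [expQuot, dslope_same]
  have := (hasDerivAt_one_sub_exp 1 0).deriv
  simpa using this

theorem mul_expQuot (z : ℂ) : z * expQuot z = 1 - Complex.exp (-z) := by
  rcases eq_or_ne z 0 with rfl | hz
  · simp
  · rw [expQuot_of_ne hz]
    field_simp

theorem differentiable_expQuot : Differentiable ℂ expQuot := by
  rw [← differentiableOn_univ]
  refine (Complex.differentiableOn_dslope univ_mem).2 ?_
  rw [differentiableOn_univ]
  fun_prop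

theorem expQuot_eq_integral (z : ℂ) :
    expQuot z = ∫ s in (0 : ℝ)..1, Complex.exp (-z * s) := by
  rcases eq_or_ne z 0 with rfl | hz
  · simp [expQuot_zero]
  · rw [expQuot_of_ne hz, integral_exp_mul_complex (neg_ne_zero.2 hz)]
    simp only [Complex.ofReal_one, mul_one, Complex.ofReal_zero, mul_zero, Complex.exp_zero]
    field_simp
    ring

/-- `expQuot z` averages `e^{-zs}` over `0 ≤ s ≤ 1`, and there `|s Im z| ≤ 1 < π / 2`. Hence the
principal logarithm of `expQuot` is holomorphic on a whole strip around the ray. -/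
theorem re_expQuot_pos {z : ℂ} (hz : |z.im| ≤ 1) : 0 < (expQuot z).re := by
  rw [expQuot_eq_integral]
  have hi : IntervalIntegrable (fun s : ℝ => Complex.exp (-z * s)) MeasureTheory.volume 0 1 :=
    Continuous.intervalIntegrable (by fun_prop) _ _
  have : (∫ s in (0 : ℝ)..1, Complex.exp (-z * s)).re
      = ∫ s in (0 : ℝ)..1, (Complex.exp (-z * s)).re := by
    have := Complex.reCLM.intervalIntegral_comp_comm hi
    simpa using this.symm
  rw [this]
  refine intervalIntegral.intervalIntegral_pos_of_pos_on
    (Continuous.intervalIntegrable (by fun_prop) _ _) (fun s hs => ?_) one_pos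
  rw [Complex.exp_re]
  refine mul_pos (Real.exp_pos _) (Real.cos_pos_of_mem_Ioo ?_)
  have h1 : |(-z * s : ℂ).im| < 1 := by
    simp only [Complex.mul_im, Complex.neg_re, Complex.ofReal_im, mul_zero, Complex.neg_im,
      Complex.ofReal_re, zero_add, abs_mul, abs_neg, abs_of_pos hs.1]
    nlinarith [hs.1, hs.2, abs_nonneg z.im]
  rw [abs_lt] at h1
  exact ⟨by linarith [Real.pi_gt_three], by linarith [Real.pi_gt_three]⟩

theorem expQuot_mem_slitPlane {z : ℂ} (hz : |z.im| ≤ 1) : expQuot z ∈ Complex.slitPlane :=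
  Or.inl (re_expQuot_pos hz)

theorem exp_logExpQuot {z : ℂ} (hz : |z.im| ≤ 1) :
    z * Complex.exp (logExpQuot z) = 1 - Complex.exp (-z) := by
  rw [logExpQuot, Complex.exp_log (Complex.slitPlane_ne_zero (expQuot_mem_slitPlane hz)),
    mul_expQuot]

theorem differentiableAt_logExpQuot {z : ℂ} (hz : |z.im| ≤ 1) :
    DifferentiableAt ℂ logExpQuot z :=
  (differentiable_expQuot z).clog (expQuot_mem_slitPlane hz)

theorem deriv_logExpQuot {z : ℂ} (hz : |z.im| ≤ 1) (hz0 : z ≠ 0) :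
    deriv logExpQuot z = expGeom 1 z - 1 / z := by
  have h1 : HasDerivAt expQuot
      ((Complex.exp (-z) * z - (1 - Complex.exp (-z))) / z ^ 2) z := by
    have h := (hasDerivAt_one_sub_exp 1 z).fun_div (hasDerivAt_id z) hz0
    simp only [one_mul, id, mul_one] at h
    refine h.congr_of_eventuallyEq ?_
    filter_upwards [isOpen_ne.mem_nhds hz0] with w hw
    exact expQuot_of_ne hw
  have h2 := expQuot_mem_slitPlane hz
  have h3 := Complex.slitPlane_ne_zero h2
  have h4 : 1 - Complex.exp (-z) ≠ 0 := by
    rw [← mul_expQuot]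
    exact mul_ne_zero hz0 h3
  rw [show deriv logExpQuot z = _ from (h1.clog h2).deriv, expQuot_of_ne hz0, expGeom]
  simp only [one_mul]
  field_simp

theorem exists_rayRegular_logExpQuot : ∃ ρ C : ℝ, RayRegular logExpQuot ρ C := by
  have hs : ∀ z ∈ rayStrip 1, |z.im| ≤ 1 := fun z hz => hz.2.le
  refine ⟨_, exists_rayRegular (σ := 1) (C := 9) one_pos le_rfl
    (fun z hz => (differentiableAt_logExpQuot (hs z hz)).differentiableWithinAt)
    (fun z hz hz1 => ?_) (fun z hz hz1 => ?_)⟩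
  · have hz0 : z ≠ 0 := by rintro rfl; simp at hz1; linarith
    have hre : 0 < z.re := by linarith
    rw [deriv_logExpQuot (hs z hz) hz0]
    have h1 := norm_expGeom_le norm_one hz1
    have h2 : ‖1 / z‖ ≤ 1 / z.re := by
      rw [norm_div, norm_one]
      gcongr
      exact Complex.re_le_norm z
    refine (norm_sub_le _ _).trans ((add_le_add h1 h2).trans ?_)
    rw [← add_div]
    gcongr
    norm_num
  · have hz0 : z ≠ 0 := by rintro rfl; simp at hz1; linarith
    have hre : 0 < z.re := by linarith
    have he : deriv logExpQuot =ᶠ[𝓝 z] fun z => expGeom 1 z - 1 / z := by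
      filter_upwards [(isOpen_rayStrip 1).mem_nhds hz, isOpen_ne.mem_nhds hz0] with w hw hw0
      exact deriv_logExpQuot (hs w hw) hw0
    have hne : 1 - 1 * Complex.exp (-z) ≠ 0 := by
      rw [one_mul, ← mul_expQuot]
      exact mul_ne_zero hz0 (Complex.slitPlane_ne_zero (expQuot_mem_slitPlane (hs z hz)))
    have h3 : HasDerivAt (fun z : ℂ => 1 / z) (-(z ^ 2)⁻¹) z := by
      simpa only [one_div] using hasDerivAt_inv hz0
    rw [he.deriv_eq, ((hasDerivAt_expGeom hne).fun_sub h3).deriv]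
    have h1 := norm_deriv_expGeom_le norm_one hz1
    have h2 : ‖-(z ^ 2)⁻¹‖ ≤ 1 / z.re ^ 2 := by
      rw [norm_neg, norm_inv, norm_pow, one_div]
      gcongr
      exact Complex.re_le_norm z
    refine (norm_sub_le _ _).trans ((add_le_add h1 h2).trans (le_of_eq ?_))
    ring

/-! ### Taylor coefficients at the origin -/

theorem analyticAt_polylogNonpos (n : ℕ) : ∀ {z : ℂ}, z ≠ 1 → AnalyticAt ℂ (polylogNonpos n) z := by
  induction n with
  | zero =>
    intro z hz
    have : (1 : ℂ) - z ≠ 0 := sub_ne_zero.2 (Ne.symm hz)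
    exact analyticAt_id.div (analyticAt_const.sub analyticAt_id) this
  | succ n ih =>
    intro z hz
    exact analyticAt_id.mul (ih hz).deriv

/-- With `u = ω e⁻ᶻ` the operator `u d/du` is `-d/dz`, so each differentiation lowers the
polylogarithm index by one and contributes a sign. -/
theorem iteratedDeriv_logOneSubExp {ω : ℂ} {σ : ℝ}
    (hs : ∀ z ∈ rayStrip σ, 1 - ω * Complex.exp (-z) ∈ Complex.slitPlane) (k : ℕ) :
    ∀ z ∈ rayStrip σ, iteratedDeriv (k + 1) (logOneSubExp ω) z
      = (-1) ^ k * polylogNonpos k (ω * Complex.exp (-z)) := by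
  induction k with
  | zero =>
    intro z hz
    simp only [zero_add, iteratedDeriv_one, pow_zero, one_mul]
    exact (hasDerivAt_logOneSubExp (hs z hz)).deriv
  | succ k ih =>
    intro z hz
    have he : iteratedDeriv (k + 1) (logOneSubExp ω)
        =ᶠ[𝓝 z] fun z => (-1) ^ k * polylogNonpos k (ω * Complex.exp (-z)) :=
      Filter.eventually_of_mem ((isOpen_rayStrip σ).mem_nhds hz) ih
    have h1 : ω * Complex.exp (-z) ≠ 1 := by
      intro h
      have := Complex.slitPlane_ne_zero (hs z hz)
      rw [h, sub_self] at this
      exact this rfl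
    have h2 : HasDerivAt (fun z : ℂ => ω * Complex.exp (-z)) (-(ω * Complex.exp (-z))) z := by
      refine (((hasDerivAt_neg z).cexp).const_mul ω).congr_deriv ?_
      ring
    have h3 := ((analyticAt_polylogNonpos k h1).differentiableAt.hasDerivAt.comp z h2).const_mul
      ((-1 : ℂ) ^ k)
    have h4 := h3.deriv
    simp only [Function.comp_def] at h4
    rw [iteratedDeriv_succ, he.deriv_eq, h4, polylogNonpos]
    ring

theorem iteratedDeriv_logOneSubExp_zero {ω : ℂ} (hω : ‖ω‖ = 1) (hω1 : ω ≠ 1) (k : ℕ) :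
    iteratedDeriv (k + 1) (logOneSubExp ω) 0 = (-1) ^ k * polylogNonpos k ω := by
  obtain ⟨σ, hσ0, _, hs⟩ := exists_strip_mem_slitPlane hω hω1
  have := iteratedDeriv_logOneSubExp hs k 0 (by simpa using ofReal_mem_rayStrip hσ0 le_rfl)
  simpa using this

theorem analyticAt_logExpQuot {z : ℂ} (hz : |z.im| < 1) : AnalyticAt ℂ logExpQuot z := by
  refine Complex.analyticAt_iff_eventually_differentiableAt.2 ?_
  filter_upwards [(isOpen_lt (continuous_abs.comp Complex.continuous_im) continuous_const).mem_nhds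
    hz] with w hw
  exact differentiableAt_logExpQuot (le_of_lt hw)

theorem iteratedDeriv_id_zero (n : ℕ) :
    iteratedDeriv n (fun z : ℂ => z) 0 = if n = 1 then 1 else 0 := by
  rcases n with _ | _ | n
  · simp
  · simp
  · rw [iteratedDeriv_succ', iteratedDeriv_succ']
    have : deriv (deriv fun z : ℂ => z) = fun _ => 0 := by
      have : (deriv fun z : ℂ => z) = fun _ => 1 := by funext; simp
      rw [this]
      funext
      simp
    rw [this]
    simp

theorem iteratedDeriv_exp_sub_one_zero (n : ℕ) :
    iteratedDeriv n (fun z : ℂ => Complex.exp z - 1) 0 = if n = 0 then 0 else 1 := by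
  rcases n with _ | n
  · simp
  · rw [iteratedDeriv_succ']
    have : (deriv fun z : ℂ => Complex.exp z - 1) = Complex.exp := by funext; simp
    rw [this, iteratedDeriv_eq_iterate, Complex.iter_deriv_exp]
    simp

/-- With `g = logExpQuot`, `b z = 1 + z g'(z)` equals `z / (e^z - 1)`, the generating function of
the Bernoulli numbers. Leibniz' rule for `b * (e^z - 1) = z` yields their recursion. -/
theorem iteratedDeriv_logExpQuot_zero (n : ℕ) :
    ((n : ℂ) + 1) * iteratedDeriv (n + 1) logExpQuot 0 = ((bernoulli (n + 1) : ℚ) : ℂ) := by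
  have hw : AnalyticAt ℂ (deriv logExpQuot) 0 := (analyticAt_logExpQuot (by simp)).deriv
  set b : ℂ → ℂ := fun z => 1 + ((fun z : ℂ => z) * deriv logExpQuot : ℂ → ℂ) z with hb
  have hbA : AnalyticAt ℂ b 0 := analyticAt_const.add (analyticAt_id.mul hw)
  have hprod : (b * fun z => Complex.exp z - 1) =ᶠ[𝓝 0] fun z => z := by
    have : ∀ᶠ z : ℂ in 𝓝 0, |z.im| < 1 :=
      (isOpen_lt (continuous_abs.comp Complex.continuous_im) continuous_const).mem_nhds (by simp)
    filter_upwards [this] with z hz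
    rcases eq_or_ne z 0 with rfl | hz0
    · simp
    · have hne : 1 - Complex.exp (-z) ≠ 0 := by
        rw [← mul_expQuot]
        exact mul_ne_zero hz0 (Complex.slitPlane_ne_zero (expQuot_mem_slitPlane hz.le))
      have h1 : Complex.exp z * Complex.exp (-z) = 1 := by
        rw [← Complex.exp_add]; simp
      simp only [hb, Pi.mul_apply, deriv_logExpQuot hz.le hz0, expGeom, one_mul]
      field_simp
      linear_combination z * h1
  have hsum : ∀ n : ℕ, ∑ i ∈ Finset.range n, (n.choose i : ℂ) * iteratedDeriv i b 0
      = if n = 1 then 1 else 0 := by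
    intro n
    rw [← iteratedDeriv_id_zero, ← hprod.iteratedDeriv_eq n,
      iteratedDeriv_mul hbA.contDiffAt (by fun_prop), Finset.sum_range_succ]
    simp only [iteratedDeriv_exp_sub_one_zero, Nat.sub_self, if_true, mul_zero, add_zero]
    refine Finset.sum_congr rfl fun i hi => ?_
    rw [if_neg (by have := Finset.mem_range.1 hi; omega), mul_one]
  have hB : ∀ n : ℕ, iteratedDeriv n b 0 = ((bernoulli n : ℚ) : ℂ) := by
    intro n
    induction n using Nat.strong_induction_on with
    | _ n ih =>
      have h1 := hsum (n + 1)
      have h2 := congrArg (fun q : ℚ => (q : ℂ)) (sum_bernoulli (n + 1))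
      rw [Finset.sum_range_succ] at h1 h2
      push_cast at h2
      have h3 : ∑ i ∈ Finset.range n, ((n + 1).choose i : ℂ) * iteratedDeriv i b 0
          = ∑ i ∈ Finset.range n, ((n + 1).choose i : ℂ) * ((bernoulli i : ℚ) : ℂ) :=
        Finset.sum_congr rfl fun i hi => by rw [ih i (Finset.mem_range.1 hi)]
      have h4 : ((n + 1).choose n : ℂ) ≠ 0 := by
        rw [Nat.choose_succ_self_right]
        exact_mod_cast Nat.succ_ne_zero n
      rw [h3] at h1
      have h5 : ((n + 1).choose n : ℂ) * iteratedDeriv n b 0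
          = ((n + 1).choose n : ℂ) * ((bernoulli n : ℚ) : ℂ) := by
        have h6 : (if n + 1 = 1 then (1 : ℂ) else 0) =
            ((if n = 0 then (1 : ℚ) else 0 : ℚ) : ℂ) := by
          rcases n with _ | n <;> simp
        linear_combination h1 - h2 + h6
      exact mul_left_cancel₀ h4 h5
  rw [← hB, hb, iteratedDeriv_const_add (Nat.succ_pos n),
    iteratedDeriv_mul (by fun_prop) hw.contDiffAt]
  -- At `0`, only the term of Leibniz' rule that differentiates the factor `z` exactly once
  -- survives.
  rw [Finset.sum_eq_single 1]
  · rw [iteratedDeriv_id_zero, iteratedDeriv_succ']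
    simp
  · intro i _ hi
    simp [iteratedDeriv_id_zero, hi]
  · intro h
    exact absurd (Finset.mem_range.2 (by omega)) h

theorem logExpQuot_zero : logExpQuot 0 = 0 := by simp [logExpQuot, expQuot_zero]

theorem iteratedDeriv_comp_mul_left_apply (c : ℂ) (g : ℂ → ℂ) (n : ℕ) :
    iteratedDeriv n (fun z => g (c * z)) = fun z => c ^ n * iteratedDeriv n g (c * z) := by
  induction n with
  | zero => simp
  | succ n ih =>
    funext z
    rw [iteratedDeriv_succ, ih, iteratedDeriv_succ, deriv_const_mul_field,
      deriv_comp_mul_left, smul_eq_mul]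
    ring

/-- Logarithmic derivative of `2 expQuot(2z) = expQuot(z) (1 + e⁻ᶻ)`. Working with derivatives
avoids comparing branches of the logarithm. -/
theorem deriv_logOneSubExp_neg_one {z : ℂ} (hz : |z.im| < 1 / 2) :
    deriv (logOneSubExp (-1)) z = 2 * deriv logExpQuot (2 * z) - deriv logExpQuot z := by
  have hz2 : |(2 * z).im| ≤ 1 := by
    simp only [Complex.mul_im, Complex.re_ofNat, Complex.im_ofNat, zero_mul, add_zero, abs_mul,
      Nat.abs_ofNat]
    linarith
  have hid : (fun z : ℂ => 2 * expQuot (2 * z)) =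
      fun z => expQuot z * (1 - (-1) * Complex.exp (-z)) := by
    funext z
    rcases eq_or_ne z 0 with rfl | h0
    · simp [expQuot_zero]; norm_num
    · rw [expQuot_of_ne h0, expQuot_of_ne (mul_ne_zero two_ne_zero h0)]
      have : Complex.exp (-(2 * z)) = Complex.exp (-z) ^ 2 := by
        rw [← Complex.exp_nat_mul]; congr 1; push_cast; ring
      rw [this]
      field_simp
      ring
  have e1 := (differentiable_expQuot z).hasDerivAt
  have e2 : HasDerivAt (fun z : ℂ => 2 * expQuot (2 * z))
      (2 * (deriv expQuot (2 * z) * (2 * 1))) z :=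
    ((differentiable_expQuot (2 * z)).hasDerivAt.comp z ((hasDerivAt_id z).const_mul 2)).const_mul 2
  have e3 := e1.fun_mul (hasDerivAt_one_sub_exp (-1) z)
  rw [← hid] at e3
  have e4 := e2.unique e3
  have n1 := Complex.slitPlane_ne_zero (expQuot_mem_slitPlane (z := z) (by linarith))
  have n2 := Complex.slitPlane_ne_zero (expQuot_mem_slitPlane hz2)
  have hv := congrFun hid z
  have hs : 1 - (-1) * Complex.exp (-z) ∈ Complex.slitPlane := by
    refine Complex.mem_slitPlane_iff.2 (Or.inl ?_)
    simp only [Complex.add_re, Complex.one_re, neg_mul, one_mul, Complex.exp_re, Complex.neg_im,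
      Real.cos_neg, sub_neg_eq_add]
    have : 0 < Real.cos z.im := by
      rw [abs_lt] at hz
      exact Real.cos_pos_of_mem_Ioo ⟨by linarith [Real.pi_gt_three], by linarith [Real.pi_gt_three]⟩
    positivity
  have n3 := Complex.slitPlane_ne_zero hs
  rw [(hasDerivAt_logOneSubExp hs).deriv, show deriv logExpQuot z = deriv expQuot z / expQuot z from
    (e1.clog (expQuot_mem_slitPlane (by linarith))).deriv,
    show deriv logExpQuot (2 * z) = deriv expQuot (2 * z) / expQuot (2 * z) from
    ((differentiable_expQuot (2 * z)).hasDerivAt.clog (expQuot_mem_slitPlane hz2)).deriv, expGeom]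
  have : expQuot (2 * z) = expQuot z * (1 - (-1) * Complex.exp (-z)) / 2 := by
    rw [← hv]; ring
  rw [this]
  have e5 : deriv expQuot (2 * z) = (deriv expQuot z * (1 - (-1) * Complex.exp (-z))
      + expQuot z * ((-1) * Complex.exp (-z))) / 4 := by
    rw [← e4]; ring
  rw [e5]
  have n4 : 1 + Complex.exp (-z) ≠ 0 := by simpa using n3
  simp only [neg_mul, one_mul, sub_neg_eq_add]
  field_simp
  ring

theorem iteratedDeriv_logOneSubExp_neg_one_zero (n : ℕ) :
    iteratedDeriv (n + 1) (logOneSubExp (-1)) 0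
      = (2 ^ (n + 1) - 1) * iteratedDeriv (n + 1) logExpQuot 0 := by
  have he : deriv (logOneSubExp (-1)) =ᶠ[𝓝 0]
      fun z => 2 * deriv logExpQuot (2 * z) - deriv logExpQuot z := by
    have : ∀ᶠ z : ℂ in 𝓝 0, |z.im| < 1 / 2 :=
      (isOpen_lt (continuous_abs.comp Complex.continuous_im) continuous_const).mem_nhds (by simp)
    filter_upwards [this] with z hz
    exact deriv_logOneSubExp_neg_one hz
  have hw : AnalyticAt ℂ (deriv logExpQuot) 0 := (analyticAt_logExpQuot (by simp)).deriv
  have hw2 : AnalyticAt ℂ (fun z => 2 * deriv logExpQuot (2 * z)) 0 := by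
    refine analyticAt_const.mul (AnalyticAt.fun_comp (by simpa using hw) ?_)
    fun_prop
  rw [iteratedDeriv_succ', he.iteratedDeriv_eq n, iteratedDeriv_fun_sub hw2.contDiffAt
    hw.contDiffAt,
    iteratedDeriv_const_mul_field, iteratedDeriv_comp_mul_left_apply, iteratedDeriv_succ']
  simp only [mul_zero]
  ring

/-! ### The dilogarithm on the closed unit disc -/

theorem polylog_two (z : ℂ) : polylog 2 z = ∑' n : ℕ, z ^ (n + 1) / ((n : ℂ) + 1) ^ 2 := by
  simp only [polylog, zero_lt_two, if_true]
  rfl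

theorem summable_inv_succ_sq : Summable fun n : ℕ => 1 / ((n : ℝ) + 1) ^ 2 := by
  have := (summable_nat_add_iff 1).2 (Real.summable_one_div_nat_pow.2 one_lt_two)
  simpa using this

theorem norm_dilog_term_le {z : ℂ} (hz : ‖z‖ ≤ 1) (n : ℕ) :
    ‖z ^ (n + 1) / ((n : ℂ) + 1) ^ 2‖ ≤ 1 / ((n : ℝ) + 1) ^ 2 := by
  rw [norm_div, norm_pow, norm_pow, show ((n : ℂ) + 1) = ((n + 1 : ℕ) : ℂ) by push_cast; rfl,
    Complex.norm_natCast]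
  push_cast
  gcongr
  exact pow_le_one₀ (norm_nonneg z) hz

theorem summable_dilog {z : ℂ} (hz : ‖z‖ ≤ 1) :
    Summable fun n : ℕ => z ^ (n + 1) / ((n : ℂ) + 1) ^ 2 :=
  .of_norm_bounded summable_inv_succ_sq (norm_dilog_term_le hz)

theorem continuousOn_dilog : ContinuousOn (polylog 2) (Metric.closedBall 0 1) := by
  rw [show polylog 2 = fun z => ∑' n : ℕ, z ^ (n + 1) / ((n : ℂ) + 1) ^ 2 from
    funext polylog_two]
  refine continuousOn_tsum (fun n => ?_) summable_inv_succ_sq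
    (fun n z hz => norm_dilog_term_le (by simpa using hz) n)
  fun_prop

theorem dilog_zero : polylog 2 0 = 0 := by simp [polylog_two]

theorem hasSum_dilog_one :
    HasSum (fun n : ℕ => (1 : ℂ) / ((n : ℂ) + 1) ^ 2) ((Real.pi : ℂ) ^ 2 / 6) := by
  have h := (hasSum_nat_add_iff' 1).2 hasSum_zeta_two
  have h2 := (Complex.hasSum_ofReal).2 h
  simpa using h2

theorem dilog_one : polylog 2 1 = (Real.pi : ℂ) ^ 2 / 6 := by
  rw [polylog_two, ← hasSum_dilog_one.tsum_eq]
  simp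

/-- In `Li₂(1) + Li₂(-1)` the odd powers cancel and the even ones give `Li₂(1) / 2`. -/
theorem dilog_neg_one : polylog 2 (-1) = -((Real.pi : ℂ) ^ 2 / 12) := by
  have h1 := summable_dilog (z := 1) (by simp)
  have h2 := summable_dilog (z := -1) (by simp)
  have hs := h1.add h2
  have e := tsum_even_add_odd (f := fun n : ℕ => (1 : ℂ) ^ (n + 1) / ((n : ℂ) + 1) ^ 2
      + (-1) ^ (n + 1) / ((n : ℂ) + 1) ^ 2)
    (hs.comp_injective (mul_right_injective₀ two_ne_zero))
    (hs.comp_injective ((add_left_injective 1).comp (mul_right_injective₀ two_ne_zero)))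
  rw [h1.tsum_add h2, ← polylog_two, ← polylog_two, dilog_one] at e
  have e1 : ∀ k : ℕ, (1 : ℂ) ^ (2 * k + 1) / (((2 * k : ℕ) : ℂ) + 1) ^ 2
      + (-1) ^ (2 * k + 1) / (((2 * k : ℕ) : ℂ) + 1) ^ 2 = 0 := by
    intro k
    rw [pow_succ (-1 : ℂ), pow_mul]
    simp [neg_div]
  have e2 : ∀ k : ℕ, (1 : ℂ) ^ (2 * k + 1 + 1) / (((2 * k + 1 : ℕ) : ℂ) + 1) ^ 2
      + (-1) ^ (2 * k + 1 + 1) / (((2 * k + 1 : ℕ) : ℂ) + 1) ^ 2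
      = 1 / 2 * (1 / ((k : ℂ) + 1) ^ 2) := by
    intro k
    have hk : (k : ℂ) + 1 ≠ 0 := Nat.cast_add_one_ne_zero k
    rw [show 2 * k + 1 + 1 = 2 * (k + 1) by ring, pow_mul (-1 : ℂ), neg_one_sq, one_pow, one_pow,
      show (((2 * k + 1 : ℕ) : ℂ) + 1) = 2 * ((k : ℂ) + 1) by push_cast; ring]
    field_simp
    norm_num
  simp only [e1, e2, tsum_zero, tsum_mul_left, hasSum_dilog_one.tsum_eq] at e
  linear_combination -e

/-- Termwise differentiation on a smaller disc. The relation for `z * D` avoids division by `z`, so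
`z = 0` is included. -/
theorem hasDerivAt_dilog {z : ℂ} (hz : ‖z‖ < 1) :
    ∃ D : ℂ, HasDerivAt (polylog 2) D z ∧ z * D = -Complex.log (1 - z) := by
  obtain ⟨r, hr1, hr2⟩ := exists_between hz
  have hr0 : 0 ≤ r := (norm_nonneg z).trans hr1.le
  refine ⟨∑' n : ℕ, z ^ n / ((n : ℂ) + 1), ?_, ?_⟩
  · have hterm : ∀ (n : ℕ) (y : ℂ), HasDerivAt (fun z : ℂ => z ^ (n + 1) / ((n : ℂ) + 1) ^ 2)
        (y ^ n / ((n : ℂ) + 1)) y := by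
      intro n y
      refine ((hasDerivAt_pow (n + 1) y).div_const _).congr_deriv ?_
      have : (n : ℂ) + 1 ≠ 0 := Nat.cast_add_one_ne_zero n
      push_cast
      field_simp
    have hbd : ∀ (n : ℕ) (y : ℂ), y ∈ Metric.ball (0 : ℂ) r → ‖y ^ n / ((n : ℂ) + 1)‖ ≤ r ^ n := by
      intro n y hy
      have hy : ‖y‖ < r := by simpa using hy
      have h1 : (1 : ℝ) ≤ ((n + 1 : ℕ) : ℝ) := by simp
      rw [norm_div, norm_pow, show ((n : ℂ) + 1) = ((n + 1 : ℕ) : ℂ) by push_cast; rfl,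
        Complex.norm_natCast]
      exact (div_le_self (by positivity) h1).trans (pow_le_pow_left₀ (norm_nonneg y) hy.le n)
    have key := hasDerivAt_tsum_of_isPreconnected
      (g := fun (n : ℕ) (z : ℂ) => z ^ (n + 1) / ((n : ℂ) + 1) ^ 2)
      (g' := fun (n : ℕ) (z : ℂ) => z ^ n / ((n : ℂ) + 1)) (t := Metric.ball (0 : ℂ) r)
      (summable_geometric_of_lt_one hr0 hr2) Metric.isOpen_ball
      (convex_ball (0 : ℂ) r).isPreconnected (fun n y _ => hterm n y) hbd
      (Metric.mem_ball_self ((norm_nonneg z).trans_lt hr1)) (summable_dilog (by simp))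
      (show z ∈ Metric.ball (0 : ℂ) r by simpa using hr1)
    exact key.congr_of_eventuallyEq (Eventually.of_forall polylog_two)
  · have h := (hasSum_nat_add_iff' 1).2 (Complex.hasSum_taylorSeries_neg_log hz)
    simp only [Finset.range_one, Finset.sum_singleton, pow_zero, Nat.cast_zero, div_zero,
      sub_zero] at h
    rw [← h.tsum_eq, ← tsum_mul_left]
    refine tsum_congr fun n => ?_
    push_cast
    rw [pow_succ]
    ring

theorem hasDerivAt_dilog_exp {ω z : ℂ} (hω : ‖ω‖ = 1) (hz : 0 < z.re) :
    HasDerivAt (fun z => polylog 2 (ω * Complex.exp (-z))) (logOneSubExp ω z) z := by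
  have hlt : ‖ω * Complex.exp (-z)‖ < 1 := by
    rw [norm_mul_exp_neg hω, Real.exp_lt_one_iff]
    linarith
  obtain ⟨D, hD, hD2⟩ := hasDerivAt_dilog hlt
  have h2 : HasDerivAt (fun z : ℂ => ω * Complex.exp (-z)) (-(ω * Complex.exp (-z))) z := by
    refine (((hasDerivAt_neg z).cexp).const_mul ω).congr_deriv ?_
    ring
  refine (hD.comp z h2).congr_deriv ?_
  rw [logOneSubExp]
  linear_combination -hD2

theorem continuousOn_dilog_exp {ω : ℂ} (hω : ‖ω‖ = 1) :
    ContinuousOn (fun z => polylog 2 (ω * Complex.exp (-z))) {z | 0 ≤ z.re} := by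
  refine continuousOn_dilog.comp (by fun_prop) fun z hz => ?_
  have hz : 0 ≤ z.re := hz
  rw [mem_closedBall_zero_iff, norm_mul_exp_neg hω, Real.exp_le_one_iff]
  linarith

theorem tendsto_dilog_exp {ω : ℂ} (hω : ‖ω‖ = 1) :
    Tendsto (fun x : ℝ => polylog 2 (ω * Complex.exp (-(x : ℂ)))) atTop (𝓝 0) := by
  have h1 : Tendsto (fun x : ℝ => ω * Complex.exp (-(x : ℂ))) atTop (𝓝 0) := by
    rw [tendsto_zero_iff_norm_tendsto_zero]
    simp only [norm_mul_exp_neg hω, Complex.ofReal_re]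
    exact Real.tendsto_exp_neg_atTop_nhds_zero
  have h2 : ContinuousAt (polylog 2) 0 :=
    continuousOn_dilog.continuousAt (Metric.closedBall_mem_nhds _ one_pos)
  have := h2.tendsto.comp h1
  rwa [dilog_zero] at this

theorem integral_logOneSubExp {ω : ℂ} (hω : ‖ω‖ = 1) (hω1 : ω ≠ 1) {X : ℝ} (hX : 0 ≤ X) :
    ∫ y in (0 : ℝ)..X, logOneSubExp ω y = polylog 2 (ω * Complex.exp (-(X : ℂ))) - polylog 2 ω := by
  obtain ⟨ρ, C, hf⟩ := exists_rayRegular_logOneSubExp hω hω1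
  have hρ := hf.pos
  -- The derivative of `Li₂` is known only inside the disc, that is for `x > 0`; at `x = 0`
  -- continuity on the closed disc suffices.
  rw [intervalIntegral.integral_eq_sub_of_hasDeriv_right_of_le
    (f := fun x : ℝ => polylog 2 (ω * Complex.exp (-(x : ℂ)))) hX]
  · simp
  · refine (continuousOn_dilog_exp hω).comp Complex.continuous_ofReal.continuousOn fun x hx => ?_
    simpa using hx.1
  · intro x hx
    exact ((hasDerivAt_dilog_exp hω (z := x) (by simpa using hx.1)).comp_ofReal).hasDerivWithinAt
  · refine (hf.continuousOn_ofReal.mono fun y hy => ?_).intervalIntegrable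
    rw [Set.uIcc_of_le hX] at hy
    have := hy.1
    simp only [Set.mem_Ioi]
    linarith

theorem logExpQuot_ofReal {x : ℝ} (hx : 0 < x) :
    logExpQuot x = ((Real.log (1 - Real.exp (-x)) - Real.log x : ℝ) : ℂ) := by
  have h1 : 0 < 1 - Real.exp (-x) := by
    rw [sub_pos, Real.exp_lt_one_iff]
    linarith
  rw [← Real.log_div h1.ne' hx.ne', Complex.ofReal_log (by positivity), logExpQuot,
    expQuot_of_ne (by exact_mod_cast hx.ne')]
  push_cast
  rfl

theorem integral_logExpQuot {X : ℝ} (hX : 0 ≤ X) :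
    ∫ y in (0 : ℝ)..X, logExpQuot y = polylog 2 (Complex.exp (-(X : ℂ))) - (Real.pi : ℂ) ^ 2 / 6
      - ((X * Real.log X - X : ℝ) : ℂ) := by
  obtain ⟨ρ, C, hf⟩ := exists_rayRegular_logExpQuot
  have hρ := hf.pos
  rw [intervalIntegral.integral_eq_sub_of_hasDeriv_right_of_le
    (f := fun x : ℝ => polylog 2 (1 * Complex.exp (-(x : ℂ))) - ((x * Real.log x - x : ℝ) : ℂ)) hX]
  · simp [dilog_one]
    ring
  · refine ContinuousOn.sub ?_ ?_
    · refine (continuousOn_dilog_exp norm_one).comp Complex.continuous_ofReal.continuousOn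
        fun x hx => ?_
      simpa using hx.1
    · have := Real.continuous_mul_log
      fun_prop
  · intro x hx
    have h1 := (hasDerivAt_dilog_exp norm_one (z := x) (by simpa using hx.1)).comp_ofReal
    have h2 : HasDerivAt (fun x : ℝ => x * Real.log x - x) (Real.log x) x := by
      refine ((Real.hasDerivAt_mul_log hx.1.ne').sub (hasDerivAt_id x)).congr_deriv ?_
      ring
    refine ((h1.sub h2.ofReal_comp).congr_deriv ?_).hasDerivWithinAt
    rw [logExpQuot_ofReal hx.1]
    have h3 : 0 ≤ 1 - Real.exp (-x) := by
      rw [sub_nonneg, Real.exp_le_one_iff]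
      linarith [hx.1]
    rw [logOneSubExp, Complex.ofReal_sub, Complex.ofReal_log h3]
    push_cast
    rw [one_mul]
  · refine (hf.continuousOn_ofReal.mono fun y hy => ?_).intervalIntegrable
    rw [Set.uIcc_of_le hX] at hy
    have := hy.1
    simp only [Set.mem_Ioi]
    linarith

/-! ### Asymptotics of the partial products -/

/-- If a product differs from a convergent one by bounded exponentials, so does its limit. -/
theorem exists_exp_add_of_tendsto {P A r : ℕ → ℂ} {p L : ℂ} {ε : ℝ}
    (hP : Tendsto P atTop (𝓝 p)) (hA : Tendsto A atTop (𝓝 (Complex.exp L)))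
    (hr : ∀ N, ‖r N‖ ≤ ε) (h : ∀ᶠ N in atTop, P N = A N * Complex.exp (r N)) :
    ∃ R : ℂ, ‖R‖ ≤ ε ∧ p = Complex.exp (L + R) := by
  have hlim : Tendsto (fun N => P N / A N) atTop (𝓝 (p / Complex.exp L)) :=
    hP.div hA (Complex.exp_ne_zero L)
  -- The errors `r N` need not converge. The quotients `P N / A N` stay in this compact set, hence
  -- so does their limit, which therefore has a logarithm of norm at most `ε`.
  have hcl : IsClosed (Complex.exp '' Metric.closedBall (0 : ℂ) ε) :=
    ((isCompact_closedBall _ _).image Complex.continuous_exp).isClosed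
  have hA0 : ∀ᶠ N in atTop, A N ≠ 0 := hA.eventually_ne (Complex.exp_ne_zero L)
  have hmem : ∀ᶠ N in atTop, P N / A N ∈ Complex.exp '' Metric.closedBall (0 : ℂ) ε := by
    filter_upwards [h, hA0] with N hN hN0
    refine ⟨r N, by simpa using hr N, ?_⟩
    rw [hN]
    field_simp
  obtain ⟨R, hR, hRe⟩ := hcl.mem_of_tendsto hlim hmem
  refine ⟨R, by simpa using hR, ?_⟩
  rw [Complex.exp_add, hRe]
  field_simp [Complex.exp_ne_zero]

/-- Gauss' limit `N ^ a N! / ∏_{j ≤ N} (a + j) → Γ(a)` combined with Stirling's formula for `N!`. -/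
theorem tendsto_prod_gamma {a : ℂ} (ha : ∀ n : ℕ, a ≠ -(n : ℂ)) :
    Tendsto (fun N : ℕ => (∏ j ∈ Finset.range N, (a + j)) *
        Complex.exp (-(N * Real.log N) + N - (a - 1 / 2) * Real.log N)) atTop
      (𝓝 ((Real.sqrt (2 * Real.pi) : ℂ) / Complex.Gamma a)) := by
  have hΓ := Complex.Gamma_ne_zero ha
  have h1 := Complex.GammaSeq_tendsto_Gamma a
  have h2 : Tendsto (fun N : ℕ => (Stirling.stirlingSeq N : ℂ)) atTop (𝓝 (Real.sqrt Real.pi : ℂ)) :=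
    (Complex.continuous_ofReal.tendsto _).comp Stirling.tendsto_stirlingSeq_sqrt_pi
  -- `GammaSeq` includes the factor `j = N`, absent from the product here; this quotient removes it.
  have h3 : Tendsto (fun N : ℕ => (N : ℂ) / (a + N)) atTop (𝓝 1) := by
    have := tendsto_natCast_div_add_atTop (𝕜 := ℂ) a
    simpa only [add_comm] using this
  have h4 := ((h2.const_mul (Real.sqrt 2 : ℂ)).mul h3).div h1 hΓ
  have h5 : (Real.sqrt 2 : ℂ) * (Real.sqrt Real.pi : ℂ) * 1 / Complex.Gamma a
      = (Real.sqrt (2 * Real.pi) : ℂ) / Complex.Gamma a := by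
    rw [Real.sqrt_mul zero_le_two]
    push_cast
    rw [mul_one]
  rw [h5] at h4
  refine h4.congr' ?_
  filter_upwards [eventually_ge_atTop 1] with N hN
  have hN0 : (0 : ℝ) < N := by exact_mod_cast hN
  have hNc : (N : ℂ) ≠ 0 := by exact_mod_cast hN0.ne'
  have haj : ∀ j : ℕ, a + j ≠ 0 := fun j h => ha j (eq_neg_of_add_eq_zero_left h)
  have hprod : ∏ j ∈ Finset.range N, (a + (j : ℂ)) ≠ 0 := Finset.prod_ne_zero_iff.2 fun j _ => haj j
  have hfac : (N.factorial : ℂ) ≠ 0 := by exact_mod_cast Nat.factorial_ne_zero N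
  have hst : ((Stirling.stirlingSeq N : ℝ) : ℂ) * (Real.sqrt 2 : ℂ)
      = (N.factorial : ℂ) * Complex.exp (-(1 / 2 * Real.log N))
        * Complex.exp (-(N * Real.log N) + N) := by
    have e1 : Real.sqrt (2 * N) = Real.sqrt 2 * Real.exp (1 / 2 * Real.log N) := by
      rw [Real.sqrt_mul zero_le_two, Real.sqrt_eq_rpow (N : ℝ), Real.rpow_def_of_pos hN0]
      ring_nf
    have e2 : ((N : ℝ) / Real.exp 1) ^ N = Real.exp (N * Real.log N - N) := by
      rw [div_pow, Real.exp_sub, ← Real.exp_nat_mul, mul_one, Real.exp_nat_mul,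
        Real.exp_log hN0]
    have e3 : Stirling.stirlingSeq N * Real.sqrt 2
        = N.factorial * Real.exp (-(1 / 2 * Real.log N)) * Real.exp (-(N * Real.log N) + N) := by
      rw [Stirling.stirlingSeq, e1, e2,
        show -(N * Real.log N) + (N : ℝ) = -(N * Real.log N - N) by ring,
        Real.exp_neg, Real.exp_neg]
      have : Real.sqrt 2 ≠ 0 := by positivity
      field_simp
    rw [← Complex.ofReal_mul, e3]
    push_cast
    rfl
  have hpow : (N : ℂ) ^ a = Complex.exp (a * Real.log N) := by
    rw [Complex.cpow_def_of_ne_zero hNc, Complex.natCast_log, mul_comm]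
  rw [Pi.div_apply, mul_comm (Real.sqrt 2 : ℂ), hst, Complex.GammaSeq, hpow, Finset.prod_range_succ]
  have e4 : Complex.exp (-(N * Real.log N) + N - (a - 1 / 2) * Real.log N)
      * Complex.exp (a * Real.log N)
      = Complex.exp (-(1 / 2 * Real.log N)) * Complex.exp (-(N * Real.log N) + N)
        * Complex.exp (1 * Real.log N) := by
    rw [← Complex.exp_add, ← Complex.exp_add, ← Complex.exp_add]
    congr 1
    ring
  have e5 : Complex.exp (1 * Real.log N) = N := by
    rw [one_mul, ← Complex.ofReal_exp, Real.exp_log hN0]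
    simp
  rw [e5] at e4
  have := haj N
  have h6 := Complex.exp_ne_zero (a * Real.log N)
  generalize Complex.exp (a * Real.log N) = E₁ at e4 h6 ⊢
  generalize Complex.exp (-(N * Real.log N) + N - (a - 1 / 2) * Real.log N) = E₂ at e4 ⊢
  generalize Complex.exp (-(1 / 2 * Real.log N)) = E₃ at e4 ⊢
  generalize Complex.exp (-(N * Real.log N) + N) = E₄ at e4 ⊢
  field_simp
  linear_combination -e4

theorem tendsto_qPoch {q : ℂ} (hq : ‖q‖ < 1) (z : ℂ) :
    Tendsto (fun N => ∏ j ∈ Finset.range N, (1 - q ^ j * z)) atTop (𝓝 (qPoch z q)) := by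
  have hs : Summable fun n : ℕ => ‖-(q ^ n * z)‖ := by
    simp only [norm_neg, norm_mul, norm_pow]
    exact (summable_geometric_of_lt_one (norm_nonneg q) hq).mul_right _
  have := (multipliable_one_add_of_summable hs).hasProd.tendsto_prod_nat
  simpa only [qPoch, sub_eq_add_neg] using this

theorem norm_exp_neg_lt_one {t : ℝ} (ht : 0 < t) : ‖Complex.exp (-(t : ℂ))‖ < 1 := by
  rw [Complex.norm_exp, Complex.neg_re, Complex.ofReal_re, Real.exp_lt_one_iff]
  linarith

theorem exp_neg_pow_mul (a : ℂ) (t : ℝ) (j : ℕ) :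
    Complex.exp (-(t : ℂ)) ^ j * Complex.exp (-(a * t)) = Complex.exp (-((a + j) * t)) := by
  rw [← Complex.exp_nat_mul, ← Complex.exp_add]
  congr 1
  ring

theorem tendsto_logOneSubExp {ω : ℂ} (hω : ‖ω‖ = 1) :
    Tendsto (fun x : ℝ => logOneSubExp ω x) atTop (𝓝 0) := by
  have h1 : Tendsto (fun x : ℝ => ω * Complex.exp (-(x : ℂ))) atTop (𝓝 0) := by
    rw [tendsto_zero_iff_norm_tendsto_zero]
    simp only [norm_mul_exp_neg hω, Complex.ofReal_re]
    exact Real.tendsto_exp_neg_atTop_nhds_zero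
  have h2 := (h1.const_sub 1).clog (by simp)
  simpa [logOneSubExp] using h2

theorem tendsto_natCast_mul_atTop {t : ℝ} (ht : 0 < t) :
    Tendsto (fun N : ℕ => (N : ℝ) * t) atTop atTop :=
  tendsto_natCast_atTop_atTop.atTop_mul_const ht

/-- Euler–Maclaurin expansion of `∑ log (1 - ω e^{-(a + j) t})`. -/
theorem exists_sum_logOneSubExp_expansion {ω : ℂ} (hω : ‖ω‖ = 1) (hω1 : ω ≠ 1) {M : ℕ}
    (hM : 1 ≤ M) (A : ℝ) :
    ∃ B δ : ℝ, 0 ≤ B ∧ 0 < δ ∧ ∀ t : ℝ, 0 < t → t < δ → ∀ a : ℂ, ‖a‖ ≤ A → ∃ r : ℕ → ℂ,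
      (∀ N, ‖r N‖ ≤ B * t ^ M) ∧
      Tendsto (fun N => ∑ j ∈ Finset.range N, logOneSubExp ω ((a + j) * t) - r N) atTop
        (𝓝 (-((t : ℂ)⁻¹ * polylog 2 ω) - ∑ k ∈ Finset.Icc 1 M,
          bernoulliValue k a / (k.factorial : ℂ) * (t : ℂ) ^ (k - 1)
            * iteratedDeriv (k - 1) (logOneSubExp ω) 0)) := by
  obtain ⟨ρ, C, hf⟩ := exists_rayRegular_logOneSubExp hω hω1
  obtain ⟨B, δ, hB, hδ, h⟩ := hf.euler_maclaurin hM A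
  -- The remainder itself is taken as `r`, so the difference is the explicit main part, whose limit
  -- is found term by term.
  refine ⟨B, δ, hB, hδ, fun t ht htδ a ha => ⟨_, h t ht htδ a ha, ?_⟩⟩
  simp only [sub_sub_cancel]
  have hX := tendsto_natCast_mul_atTop ht
  have h1 : Tendsto (fun N : ℕ => (t : ℂ)⁻¹ * ∫ y in (0 : ℝ)..(N * t), logOneSubExp ω y) atTop
      (𝓝 ((t : ℂ)⁻¹ * (0 - polylog 2 ω))) := by
    refine (Tendsto.congr (fun N => ?_) (((tendsto_dilog_exp hω).comp hX).sub_const _)).const_mul _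
    rw [integral_logOneSubExp hω hω1 (by positivity)]
    rfl
  have h2 : ∀ k ∈ Finset.Icc 1 M, Tendsto (fun N : ℕ =>
      bernoulliValue k a / (k.factorial : ℂ) * (t : ℂ) ^ (k - 1)
        * (iteratedDeriv (k - 1) (logOneSubExp ω) ((N * t : ℝ) : ℂ)
          - iteratedDeriv (k - 1) (logOneSubExp ω) 0)) atTop
      (𝓝 (bernoulliValue k a / (k.factorial : ℂ) * (t : ℂ) ^ (k - 1)
        * (0 - iteratedDeriv (k - 1) (logOneSubExp ω) 0))) := by
    intro k _
    refine Tendsto.const_mul _ (Tendsto.sub_const ?_ _)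
    rcases k - 1 with _ | n
    · simpa only [iteratedDeriv_zero] using! (tendsto_logOneSubExp hω).comp hX
    · exact (hf.tendsto_iteratedDeriv n).comp hX
  convert h1.add (tendsto_finsetSum _ h2) using 2
  simp only [zero_sub, mul_neg, Finset.sum_neg_distrib]
  ring

theorem exists_qPoch_neg_exp_expansion {M : ℕ} (hM : 1 ≤ M) (A : ℝ) :
    ∃ B δ : ℝ, 0 ≤ B ∧ 0 < δ ∧ ∀ t : ℝ, 0 < t → t < δ → ∀ a : ℂ, ‖a‖ ≤ A → ∃ R : ℂ,
      ‖R‖ ≤ B * t ^ M ∧ qPoch (-Complex.exp (-(a * t))) (Complex.exp (-(t : ℂ)))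
        = Complex.exp (((t : ℂ)⁻¹ * ((Real.pi : ℂ) ^ 2 / 12) - ∑ k ∈ Finset.Icc 1 M,
          bernoulliValue k a / (k.factorial : ℂ) * (t : ℂ) ^ (k - 1)
            * iteratedDeriv (k - 1) (logOneSubExp (-1)) 0) + R) := by
  obtain ⟨B, δ, hB, hδ, h⟩ := exists_sum_logOneSubExp_expansion (ω := -1) (by simp)
    (by norm_num) hM A
  refine ⟨B, min δ (1 / (|A| + 1)), hB, by positivity, fun t ht htδ a ha => ?_⟩
  obtain ⟨r, hr, hlim⟩ := h t ht (htδ.trans_le (min_le_left _ _)) a ha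
  have hAt : ‖a‖ * t < 1 := by
    have h1 := htδ.trans_le (min_le_right _ _)
    rw [lt_div_iff₀ (by positivity)] at h1
    nlinarith [le_abs_self A]
  rw [dilog_neg_one, mul_neg, neg_neg] at hlim
  refine exists_exp_add_of_tendsto (tendsto_qPoch (norm_exp_neg_lt_one ht) _)
    ((Complex.continuous_exp.tendsto _).comp hlim) hr (Eventually.of_forall fun N => ?_)
  simp only [Function.comp_apply]
  rw [← Complex.exp_add, sub_add_cancel, Complex.exp_sum]
  refine Finset.prod_congr rfl fun j _ => ?_
  -- The imaginary part does not depend on `j`, and being below `π / 2` it gives `1 + e^{-(a+j)t}` a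
  -- positive real part, also when `Re a < 0`.
  have him : |((a + j) * t : ℂ).im| < 1 := by
    simp only [Complex.mul_im, Complex.add_re, Complex.add_im, Complex.natCast_re,
      Complex.natCast_im, Complex.ofReal_re, Complex.ofReal_im, mul_zero, add_zero, zero_add,
      abs_mul, abs_of_pos ht]
    exact (mul_le_mul_of_nonneg_right (Complex.abs_im_le_norm a) ht.le).trans_lt hAt
  have hne : 1 - -1 * Complex.exp (-((a + j) * t)) ≠ 0 := by
    intro h0
    have h1 := congrArg Complex.re h0
    simp only [neg_mul, one_mul, sub_neg_eq_add, Complex.add_re, Complex.one_re, Complex.exp_re,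
      Complex.neg_im, Real.cos_neg, Complex.zero_re] at h1
    rw [abs_lt] at him
    have h2 : 0 < Real.cos ((a + j) * t : ℂ).im :=
      Real.cos_pos_of_mem_Ioo ⟨by linarith [Real.pi_gt_three], by linarith [Real.pi_gt_three]⟩
    have := mul_pos (Real.exp_pos (-((a + j) * t : ℂ)).re) h2
    linarith
  rw [logOneSubExp, Complex.exp_log hne, mul_neg, exp_neg_pow_mul]
  ring

/-- Each factor splits as `1 - e⁻ᶻ = z * exp (logExpQuot z)` at `z = (a + j) t`. The linear factors
give the Gamma function, the exponentials are handled by Euler–Maclaurin, and the divergent parts of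
the two cancel. -/
theorem exists_qPoch_exp_expansion {M : ℕ} (hM : 1 ≤ M) (A : ℝ) :
    ∃ B δ : ℝ, 0 ≤ B ∧ 0 < δ ∧ ∀ t : ℝ, 0 < t → t < δ → ∀ a : ℂ, ‖a‖ ≤ A →
      (∀ n : ℕ, a ≠ -(n : ℂ)) → ∃ R : ℂ,
      ‖R‖ ≤ B * t ^ M ∧ qPoch (Complex.exp (-(a * t))) (Complex.exp (-(t : ℂ)))
        = Complex.exp ((-Complex.log (Complex.Gamma a / (Real.sqrt (2 * Real.pi) : ℂ))
          + ((t : ℂ)⁻¹ * (-((Real.pi : ℂ) ^ 2 / 6)) - (a - 1 / 2) * (Real.log t : ℂ)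
          - ∑ k ∈ Finset.Icc 1 M,
          bernoulliValue k a / (k.factorial : ℂ) * (t : ℂ) ^ (k - 1)
            * iteratedDeriv (k - 1) logExpQuot 0)) + R) := by
  obtain ⟨ρ, C, hf⟩ := exists_rayRegular_logExpQuot
  obtain ⟨B, δ, hB, hδ, h⟩ := hf.euler_maclaurin hM A
  refine ⟨B, min δ (1 / (|A| + 1)), hB, by positivity, fun t ht htδ a ha han => ?_⟩
  have hAt : ‖a‖ * t < 1 := by
    have h1 := htδ.trans_le (min_le_right _ _)
    rw [lt_div_iff₀ (by positivity)] at h1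
    nlinarith [le_abs_self A]
  have hr := h t ht (htδ.trans_le (min_le_left _ _)) a ha
  set V : ℕ → ℂ := fun N => (t : ℂ)⁻¹ * (∫ y in (0 : ℝ)..(N * t), logExpQuot y)
    + ∑ k ∈ Finset.Icc 1 M, bernoulliValue k a / (k.factorial : ℂ) * (t : ℂ) ^ (k - 1)
      * (iteratedDeriv (k - 1) logExpQuot ((N * t : ℝ) : ℂ) - iteratedDeriv (k - 1) logExpQuot 0)
    with hV
  have hX := tendsto_natCast_mul_atTop ht
  have htc : (t : ℂ) ≠ 0 := by exact_mod_cast ht.ne'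
  have hΓ := Complex.Gamma_ne_zero han
  have hpi : (Real.sqrt (2 * Real.pi) : ℂ) ≠ 0 := by
    have : 0 < Real.sqrt (2 * Real.pi) := by positivity
    exact_mod_cast this.ne'
  -- the limit of the smooth part
  have h2 : ∀ k ∈ Finset.Icc 1 M, Tendsto (fun N : ℕ =>
      bernoulliValue k a / (k.factorial : ℂ) * (t : ℂ) ^ (k - 1)
        * (iteratedDeriv (k - 1) logExpQuot ((N * t : ℝ) : ℂ)
          - iteratedDeriv (k - 1) logExpQuot 0)
        -- The boundary term `k = 1` contains `logExpQuot (N t) ≈ -log (N t)` and diverges; the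
        -- added `log N` leaves the finite contribution `-(a - 1/2) log t`.
        + if k = 1 then (a - 1 / 2) * (Real.log N : ℂ) else 0) atTop
      (𝓝 ((if k = 1 then -((a - 1 / 2) * (Real.log t : ℂ)) else 0)
        - bernoulliValue k a / (k.factorial : ℂ) * (t : ℂ) ^ (k - 1)
        * iteratedDeriv (k - 1) logExpQuot 0)) := by
    intro k hk
    have hk1 := (Finset.mem_Icc.1 hk).1
    obtain ⟨n, rfl⟩ : ∃ n, k = n + 1 := ⟨k - 1, by omega⟩
    rcases n with _ | n
    · simp only [zero_add, Nat.sub_self, pow_zero, Nat.factorial_one, Nat.cast_one, div_one,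
        mul_one, iteratedDeriv_zero, logExpQuot_zero, sub_zero, mul_zero, if_true,
        bernoulliValue_one]
      have hlog : Tendsto (fun N : ℕ => ((Real.log (1 - Real.exp (-(N * t))) - Real.log t : ℝ) : ℂ))
          atTop (𝓝 ((Real.log (1 - 0) - Real.log t : ℝ) : ℂ)) := by
        refine (Complex.continuous_ofReal.tendsto _).comp (Tendsto.sub_const ?_ _)
        refine Tendsto.log ?_ (by norm_num)
        exact (Real.tendsto_exp_neg_atTop_nhds_zero.comp hX).const_sub 1
      have hlog2 := hlog.const_mul (a - 1 / 2)
      refine (hlog2.congr' ?_).trans (le_of_eq ?_)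
      · filter_upwards [eventually_ge_atTop 1] with N hN
        have hN0 : (0 : ℝ) < N := by exact_mod_cast hN
        rw [logExpQuot_ofReal (by positivity), Real.log_mul hN0.ne' ht.ne']
        push_cast
        ring
      · congr 1
        simp
    · have hn1 : n + 1 + 1 ≠ 1 := by omega
      simp only [if_neg hn1, add_zero, zero_sub, ← mul_neg]
      refine Tendsto.const_mul _ ?_
      have := ((hf.tendsto_iteratedDeriv n).comp hX).sub_const (iteratedDeriv (n + 1) logExpQuot 0)
      rw [zero_sub] at this
      exact this
  -- `N log t` comes from the factor `t ^ N`, the other added terms undo the normalisation in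
  -- `tendsto_prod_gamma`; they cancel the growth `-(N log (N t) - N)` of the integral divided by
  -- `t`, and that of the term `k = 1`.
  have hU : Tendsto (fun N : ℕ => V N + N * (Real.log t : ℂ) + N * (Real.log N : ℂ) - N
        + (a - 1 / 2) * (Real.log N : ℂ)) atTop
      (𝓝 ((t : ℂ)⁻¹ * (-((Real.pi : ℂ) ^ 2 / 6)) - (a - 1 / 2) * (Real.log t : ℂ)
          - ∑ k ∈ Finset.Icc 1 M,
          bernoulliValue k a / (k.factorial : ℂ) * (t : ℂ) ^ (k - 1)
            * iteratedDeriv (k - 1) logExpQuot 0)) := by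
    have hdl := (((tendsto_dilog_exp norm_one).comp hX).sub_const
      ((Real.pi : ℂ) ^ 2 / 6)).const_mul (t : ℂ)⁻¹
    have hmem : 1 ∈ Finset.Icc 1 M := Finset.mem_Icc.2 ⟨le_rfl, hM⟩
    refine ((hdl.add (tendsto_finsetSum _ h2)).congr' ?_).trans (le_of_eq ?_)
    · filter_upwards [eventually_ge_atTop 1] with N hN
      have hN0 : (0 : ℝ) < N := by exact_mod_cast hN
      simp only [hV, Finset.sum_add_distrib, Finset.sum_ite_eq', hmem, if_true,
        Function.comp_apply, one_mul]
      rw [integral_logExpQuot (by positivity), Real.log_mul hN0.ne' ht.ne']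
      push_cast
      field_simp
      ring
    · congr 1
      simp only [Finset.sum_sub_distrib, Finset.sum_ite_eq', hmem, if_true]
      ring
  have hA : Tendsto (fun N : ℕ => ((∏ j ∈ Finset.range N, (a + j)) *
        Complex.exp (-(N * Real.log N) + N - (a - 1 / 2) * Real.log N)) *
        Complex.exp (V N + N * (Real.log t : ℂ) + N * (Real.log N : ℂ) - N
        + (a - 1 / 2) * (Real.log N : ℂ))) atTop (𝓝 (Complex.exp
        (-Complex.log (Complex.Gamma a / (Real.sqrt (2 * Real.pi) : ℂ))
          + ((t : ℂ)⁻¹ * (-((Real.pi : ℂ) ^ 2 / 6)) - (a - 1 / 2) * (Real.log t : ℂ)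
          - ∑ k ∈ Finset.Icc 1 M,
          bernoulliValue k a / (k.factorial : ℂ) * (t : ℂ) ^ (k - 1)
            * iteratedDeriv (k - 1) logExpQuot 0)))) := by
    have := (tendsto_prod_gamma han).mul ((Complex.continuous_exp.tendsto _).comp hU)
    rwa [Complex.exp_add, Complex.exp_neg (Complex.log _), Complex.exp_log (div_ne_zero hΓ hpi),
      inv_div]
  refine exists_exp_add_of_tendsto (tendsto_qPoch (norm_exp_neg_lt_one ht) _) hA hr
    (Eventually.of_forall fun N => ?_)
  have hfac : ∀ j ∈ Finset.range N, 1 - Complex.exp (-(t : ℂ)) ^ j * Complex.exp (-(a * t))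
      = (a + j) * t * Complex.exp (logExpQuot ((a + j) * t)) := by
    intro j _
    rw [exp_neg_pow_mul, exp_logExpQuot]
    simp only [Complex.mul_im, Complex.add_re, Complex.add_im, Complex.natCast_re,
      Complex.natCast_im, Complex.ofReal_re, Complex.ofReal_im, mul_zero, add_zero, zero_add,
      abs_mul, abs_of_pos ht]
    exact ((mul_le_mul_of_nonneg_right (Complex.abs_im_le_norm a) ht.le).trans_lt hAt).le
  have htN : (t : ℂ) ^ N = Complex.exp (N * (Real.log t : ℂ)) := by
    rw [Complex.exp_nat_mul, ← Complex.ofReal_exp, Real.exp_log ht]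
  rw [Finset.prod_congr rfl hfac, Finset.prod_mul_distrib, Finset.prod_mul_distrib,
    Finset.prod_const, Finset.card_range, htN, ← Complex.exp_sum, mul_assoc, mul_assoc, mul_assoc,
    ← Complex.exp_add, ← Complex.exp_add, ← Complex.exp_add]
  congr 2
  ring

/-! ### `G_q` at `q ^ a` and `- q ^ a` -/

theorem bernoulliValue_zero (n : ℕ) : bernoulliValue n 0 = ((bernoulli n : ℚ) : ℂ) := by
  have h := Polynomial.aeval_algebraMap_apply ℂ (0 : ℚ) (Polynomial.bernoulli n)
  simpa [bernoulliValue, Polynomial.bernoulli_eval_zero] using h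

theorem logOneSubExp_neg_one_zero : logOneSubExp (-1) 0 = (Real.log 2 : ℂ) := by
  rw [logOneSubExp, Complex.ofReal_log zero_le_two]
  norm_num

theorem iteratedDeriv_logExpQuot_zero' {n : ℕ} (hn : 1 ≤ n) :
    iteratedDeriv n logExpQuot 0 = ((bernoulli n : ℚ) : ℂ) / n := by
  obtain ⟨n, rfl⟩ : ∃ k, n = k + 1 := ⟨n - 1, by omega⟩
  have h0 : (n : ℂ) + 1 ≠ 0 := Nat.cast_add_one_ne_zero n
  rw [← iteratedDeriv_logExpQuot_zero]
  push_cast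
  field_simp

theorem sum_Icc_two_mul_add_two {E : Type*} [AddCommMonoid E] {T S : ℕ → E}
    (heven : ∀ n, T (2 * n + 2) = 0) (hodd : ∀ n, T (2 * n + 3) = S (n + 1)) (m : ℕ) :
    ∑ k ∈ Finset.Icc 1 (2 * m + 2), T k = T 1 + ∑ k ∈ Finset.Icc 1 m, S k := by
  induction m with
  | zero =>
    have h := heven 0
    rw [mul_zero, zero_add] at h
    simp [Finset.sum_Icc_succ_top, h]
  | succ m ih =>
    rw [show 2 * (m + 1) + 2 = (2 * m + 2) + 1 + 1 by ring, Finset.sum_Icc_succ_top (by omega),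
      Finset.sum_Icc_succ_top (by omega), ih, Finset.sum_Icc_succ_top (by omega) S,
      show 2 * m + 2 + 1 + 1 = 2 * (m + 1) + 2 by ring, heven (m + 1), hodd m, add_zero, add_assoc]

/-- Let `g_n` be the derivatives of `logExpQuot` at `0`; those of `log (1 + e⁻ᶻ)` are `(2^n - 1)
g_n` for `n ≥ 1`. With `n = k - 1` and `B_k(1-a) = (-1)^k B_k(a)`, even `k` gives `(2 - 2^n) g_n`,
zero because `n = 1` or `B_n = 0`; odd `k > 1` gives `2^n g_n`; and `k = 1` gives the `log 2` term.
-/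
theorem sum_taylor_coeff_eq (a : ℂ) (h : ℝ) (m : ℕ) :
    -(∑ k ∈ Finset.Icc 1 (2 * m + 2), bernoulliValue k (1 - a) / (k.factorial : ℂ)
          * ((-h : ℝ) : ℂ) ^ (k - 1) * iteratedDeriv (k - 1) (logOneSubExp (-1)) 0)
      + ∑ k ∈ Finset.Icc 1 (2 * m + 2), bernoulliValue k a / (k.factorial : ℂ)
          * ((-h : ℝ) : ℂ) ^ (k - 1) * iteratedDeriv (k - 1) logExpQuot 0
    = (a - 1 / 2) * (Real.log 2 : ℂ) + ∑ k ∈ Finset.Icc 1 m,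
        ((bernoulli (2 * k) : ℚ) : ℂ) * bernoulliValue (2 * k + 1) a
          / (2 * (k : ℂ) * (Nat.factorial (2 * k + 1) : ℂ)) * 2 ^ (2 * k) * (h : ℂ) ^ (2 * k) := by
  have heven : ∀ n : ℕ, -(bernoulliValue (2 * n + 2) (1 - a) / ((2 * n + 2).factorial : ℂ)
          * ((-h : ℝ) : ℂ) ^ (2 * n + 1) * iteratedDeriv (2 * n + 1) (logOneSubExp (-1)) 0)
      + bernoulliValue (2 * n + 2) a / ((2 * n + 2).factorial : ℂ)
          * ((-h : ℝ) : ℂ) ^ (2 * n + 1) * iteratedDeriv (2 * n + 1) logExpQuot 0 = 0 := by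
    intro n
    rw [bernoulliValue_one_sub, iteratedDeriv_logOneSubExp_neg_one_zero,
      show 2 * n + 2 = 2 * (n + 1) by ring, pow_mul (-1 : ℂ), neg_one_sq, one_pow, one_mul]
    rcases n with _ | n
    · norm_num
    · rw [iteratedDeriv_logExpQuot_zero' (by omega),
        bernoulli_eq_zero_of_odd ⟨n + 1, rfl⟩ (by omega)]
      simp
  have hodd : ∀ n : ℕ, -(bernoulliValue (2 * n + 3) (1 - a) / ((2 * n + 3).factorial : ℂ)
          * ((-h : ℝ) : ℂ) ^ (2 * n + 2) * iteratedDeriv (2 * n + 2) (logOneSubExp (-1)) 0)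
      + bernoulliValue (2 * n + 3) a / ((2 * n + 3).factorial : ℂ)
          * ((-h : ℝ) : ℂ) ^ (2 * n + 2) * iteratedDeriv (2 * n + 2) logExpQuot 0
      = ((bernoulli (2 * (n + 1)) : ℚ) : ℂ) * bernoulliValue (2 * (n + 1) + 1) a
          / (2 * ((n + 1 : ℕ) : ℂ) * (Nat.factorial (2 * (n + 1) + 1) : ℂ)) * 2 ^ (2 * (n + 1))
          * (h : ℂ) ^ (2 * (n + 1)) := by
    intro n
    rw [bernoulliValue_one_sub, iteratedDeriv_logOneSubExp_neg_one_zero,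
      iteratedDeriv_logExpQuot_zero' (by omega), show 2 * n + 3 = 2 * (n + 1) + 1 by ring,
      show 2 * n + 1 + 1 = 2 * (n + 1) by ring,
      pow_succ (-1 : ℂ), pow_mul (-1 : ℂ), neg_one_sq, one_pow, Complex.ofReal_neg,
      Even.neg_pow (even_two_mul _)]
    have h1 : ((n + 1 : ℕ) : ℂ) ≠ 0 := Nat.cast_ne_zero.2 (Nat.succ_ne_zero n)
    have h2 : ((2 * (n + 1) + 1).factorial : ℂ) ≠ 0 := Nat.cast_ne_zero.2 (Nat.factorial_ne_zero _)
    rw [Nat.cast_mul 2 (n + 1)]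
    generalize ((n + 1 : ℕ) : ℂ) = x at h1 ⊢
    push_cast
    field_simp
    ring
  rw [← Finset.sum_neg_distrib, ← Finset.sum_add_distrib,
    sum_Icc_two_mul_add_two (S := fun k => ((bernoulli (2 * k) : ℚ) : ℂ)
      * bernoulliValue (2 * k + 1) a / (2 * (k : ℂ) * (Nat.factorial (2 * k + 1) : ℂ))
      * 2 ^ (2 * k) * (h : ℂ) ^ (2 * k)) heven hodd]
  simp only [Nat.sub_self, iteratedDeriv_zero, logExpQuot_zero, logOneSubExp_neg_one_zero,
    bernoulliValue_one, Nat.factorial_one, Nat.cast_one, pow_zero]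
  ring

/-- Expansion of `G_q(q ^ a)`, uniformly for bounded `a`. -/
theorem exists_Gfun_exp_expansion (m : ℕ) (A : ℝ) : ∃ C δ : ℝ, 0 < δ ∧
      ∀ h : ℝ, -δ < h → h < 0 → ∀ a : ℂ, ‖a‖ ≤ A → (∀ n : ℕ, a ≠ -(n : ℂ)) →
        ∃ R : ℂ, ‖R‖ ≤ C * |h| ^ (2 * (m + 1)) ∧
          Gfun (Complex.exp h) (Complex.exp (a * h)) =
            Complex.exp (-((Real.pi : ℂ) ^ 2 / 4) * (h : ℂ)⁻¹
              + (a - 1 / 2) * (Real.log (-h) : ℂ)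
              + Complex.log (Complex.Gamma a / (Real.sqrt (2 * Real.pi) : ℂ))
              + (a - 1 / 2) * (Real.log 2 : ℂ)
              + ∑ k ∈ Finset.Icc 1 m,
                  ((bernoulli (2 * k) : ℚ) : ℂ) * bernoulliValue (2 * k + 1) a
                    / (2 * (k : ℂ) * (Nat.factorial (2 * k + 1) : ℂ))
                    * 2 ^ (2 * k) * (h : ℂ) ^ (2 * k)
              + R) := by
  -- The numerator of `G_q(q ^ a)` is `(-q ^ (1-a); q)_∞`, with shift `1 - a` of norm at most `1 +
  -- A`.
  obtain ⟨B₁, δ₁, hB₁, hδ₁, H₁⟩ := exists_qPoch_neg_exp_expansion (M := 2 * m + 2)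
    (by omega) (1 + A)
  obtain ⟨B₂, δ₂, hB₂, hδ₂, H₂⟩ := exists_qPoch_exp_expansion (M := 2 * m + 2) (by omega) A
  refine ⟨B₁ + B₂, min δ₁ δ₂, lt_min hδ₁ hδ₂, fun h hδ h0 a ha han => ?_⟩
  have ht : 0 < -h := by linarith
  have htδ : -h < min δ₁ δ₂ := by linarith
  obtain ⟨R₁, hR₁, e₁⟩ := H₁ (-h) ht (htδ.trans_le (min_le_left _ _)) (1 - a)
    ((norm_sub_le _ _).trans (by rw [norm_one]; linarith))
  obtain ⟨R₂, hR₂, e₂⟩ := H₂ (-h) ht (htδ.trans_le (min_le_right _ _)) a ha han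
  refine ⟨R₁ - R₂, ?_, ?_⟩
  · refine (norm_sub_le _ _).trans ((add_le_add hR₁ hR₂).trans (le_of_eq ?_))
    rw [abs_of_neg h0]
    ring
  · have hq : Complex.exp (-((-h : ℝ) : ℂ)) = Complex.exp h := by push_cast; rw [neg_neg]
    have hz : Complex.exp (-(a * ((-h : ℝ) : ℂ))) = Complex.exp (a * h) := by
      push_cast; congr 1; ring
    have hz' : -Complex.exp (-((1 - a) * ((-h : ℝ) : ℂ)))
        = -Complex.exp h * (Complex.exp (a * h))⁻¹ := by
      rw [← Complex.exp_neg, neg_mul, ← Complex.exp_add]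
      push_cast; congr 2; ring
    rw [hq, hz'] at e₁
    rw [hq, hz] at e₂
    have hs := sum_taylor_coeff_eq a h m
    rw [Gfun, e₁, e₂, ← Complex.exp_sub]
    congr 1
    have hh : (h : ℂ) ≠ 0 := by exact_mod_cast h0.ne
    have hinv : ((-h : ℝ) : ℂ)⁻¹ = -(h : ℂ)⁻¹ := by rw [Complex.ofReal_neg, inv_neg]
    rw [hinv]
    linear_combination hs

/-- The involution `z ↦ -q / z` exchanges numerator and denominator of `G_q`. -/
theorem Gfun_neg_exp (a : ℂ) (h : ℝ) :
    Gfun (Complex.exp h) (-Complex.exp (a * h))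
      = (Gfun (Complex.exp h) (Complex.exp ((1 - a) * h)))⁻¹ := by
  have h1 : -Complex.exp h * (-Complex.exp (a * h))⁻¹ = Complex.exp ((1 - a) * h) := by
    rw [inv_neg, neg_mul_neg, ← Complex.exp_neg, ← Complex.exp_add]
    congr 1; ring
  have h2 : -Complex.exp h * (Complex.exp ((1 - a) * h))⁻¹ = -Complex.exp (a * h) := by
    rw [neg_mul, ← Complex.exp_neg, ← Complex.exp_add]
    congr 2; ring
  rw [Gfun, Gfun, h1, h2, inv_div]

theorem qPoch_eq_zero {q z : ℂ} (hq : ‖q‖ < 1) {n : ℕ} (h : q ^ n * z = 1) : qPoch z q = 0 := by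
  refine tendsto_nhds_unique (tendsto_qPoch hq z) (tendsto_const_nhds.congr' ?_)
  filter_upwards [eventually_gt_atTop n] with N hN
  exact (Finset.prod_eq_zero (Finset.mem_range.2 hN) (by rw [h, sub_self])).symm

theorem norm_exp_ofReal_lt_one {h : ℝ} (h0 : h < 0) : ‖Complex.exp (h : ℂ)‖ < 1 := by
  rw [Complex.norm_exp, Complex.ofReal_re, Real.exp_lt_one_iff]
  exact h0

/-- The numerator is `(q ^ (-n); q)_∞`, whose factor of index `n` vanishes. -/
theorem Gfun_neg_exp_eq_zero (n : ℕ) {h : ℝ} (h0 : h < 0) :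
    Gfun (Complex.exp h) (-Complex.exp (((n : ℂ) + 1) * h)) = 0 := by
  rw [Gfun, qPoch_eq_zero (n := n) (norm_exp_ofReal_lt_one h0), zero_div]
  rw [inv_neg, neg_mul_neg, ← Complex.exp_neg, ← Complex.exp_nat_mul, ← Complex.exp_add,
    ← Complex.exp_add, Complex.exp_eq_one_iff]
  exact ⟨0, by push_cast; ring⟩

/-! ### The normalising constant -/

theorem qPoch_neg_one {q : ℂ} (hq : ‖q‖ < 1) : qPoch (-1) q = 2 * qPoch (-q) q := by
  have h1 := (tendsto_qPoch hq (-1)).comp (tendsto_add_atTop_nat 1)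
  refine tendsto_nhds_unique h1 (((tendsto_qPoch hq (-q)).const_mul 2).congr fun N => ?_)
  simp only [Function.comp_apply]
  rw [Finset.prod_range_succ', mul_comm]
  congr 1
  · refine Finset.prod_congr rfl fun j _ => ?_
    ring
  · norm_num

theorem qPoch_sq {q : ℂ} (hq : ‖q‖ < 1) : qPoch (q ^ 2) (q ^ 2) = qPoch q q * qPoch (-q) q := by
  have hq2 : ‖q ^ 2‖ < 1 := by
    rw [norm_pow]
    exact pow_lt_one₀ (norm_nonneg q) hq two_ne_zero
  refine tendsto_nhds_unique (tendsto_qPoch hq2 _)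
    (((tendsto_qPoch hq q).mul (tendsto_qPoch hq (-q))).congr fun N => ?_)
  rw [← Finset.prod_mul_distrib]
  refine Finset.prod_congr rfl fun j _ => ?_
  ring

/-- Both sides equal `(q; q)_∞ / (-q; q)_∞`, by `(q²; q²)_∞ = (q; q)_∞ (-q; q)_∞` and `(-1; q)_∞ = 2
(-q; q)_∞`. -/
theorem cConst_eq_two_div_Gfun {q : ℂ} (hq : ‖q‖ < 1) (hq0 : q ≠ 0) :
    cConst q = 2 * (Gfun q q)⁻¹ := by
  rw [cConst, Gfun, qPoch_sq hq, inv_div, neg_mul, mul_inv_cancel₀ hq0, qPoch_neg_one hq]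
  by_cases h : qPoch q q = 0
  · simp [h]
  · by_cases h' : qPoch (-q) q = 0
    · simp [h']
    · field_simp

theorem exists_cConst_expansion (m : ℕ) : ∃ C δ : ℝ, 0 < δ ∧ ∀ h : ℝ, -δ < h → h < 0 →
    ∃ R : ℂ, ‖R‖ ≤ C * |h| ^ (2 * (m + 1)) ∧ cConst (Complex.exp h) =
          Complex.exp ((Real.pi : ℂ) ^ 2 / 4 * (h : ℂ)⁻¹ - 1 / 2 * (Real.log (-h) : ℂ)
            + (Real.log (Real.sqrt (4 * Real.pi)) : ℂ) + R) := by
  obtain ⟨C, δ, hδ, H⟩ := exists_Gfun_exp_expansion m 1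
  refine ⟨C, δ, hδ, fun h hhδ h0 => ?_⟩
  obtain ⟨R, hR, e⟩ := H h hhδ h0 1 (by simp) (fun n hn => by
    have := congrArg Complex.re hn
    simp only [Complex.one_re, Complex.neg_re, Complex.natCast_re] at this
    linarith [n.cast_nonneg (α := ℝ)])
  refine ⟨-R, by rwa [norm_neg], ?_⟩
  rw [cConst_eq_two_div_Gfun (norm_exp_ofReal_lt_one h0) (Complex.exp_ne_zero _)]
  rw [one_mul] at e
  rw [e, ← Complex.exp_neg]
  -- `B_{2k+1}(1) = -B_{2k+1}(0) = 0` for `k ≥ 1`, so no power of `h` appears at any order.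
  have hsum : ∑ k ∈ Finset.Icc 1 m,
                  ((bernoulli (2 * k) : ℚ) : ℂ) * bernoulliValue (2 * k + 1) 1
                    / (2 * (k : ℂ) * (Nat.factorial (2 * k + 1) : ℂ))
                    * 2 ^ (2 * k) * (h : ℂ) ^ (2 * k) = 0 := by
    refine Finset.sum_eq_zero fun k hk => ?_
    have hk1 := (Finset.mem_Icc.1 hk).1
    have : bernoulliValue (2 * k + 1) 1 = 0 := by
      have := bernoulliValue_one_sub (2 * k + 1) 0
      rw [sub_zero] at this
      rw [this, bernoulliValue_zero, bernoulli_eq_zero_of_odd ⟨k, rfl⟩ (by omega)]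
      simp
    rw [this]
    simp
  have h2 : (2 : ℂ) = Complex.exp (Real.log 2 : ℂ) := by
    rw [← Complex.ofReal_exp, Real.exp_log two_pos]
    norm_num
  have hlog : Complex.log (1 / (Real.sqrt (2 * Real.pi) : ℂ))
      = ((-(Real.log (Real.sqrt (2 * Real.pi))) : ℝ) : ℂ) := by
    rw [← Real.log_inv, Complex.ofReal_log (by positivity)]
    push_cast
    rw [one_div]
  have hreal : Real.log 2 - (1 / 2) * Real.log 2 + Real.log (Real.sqrt (2 * Real.pi))
      = Real.log (Real.sqrt (4 * Real.pi)) := by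
    rw [Real.log_sqrt (by positivity), Real.log_sqrt (by positivity),
      show 4 * Real.pi = 2 * (2 * Real.pi) by ring,
      Real.log_mul two_ne_zero (by positivity : 2 * Real.pi ≠ 0)]
    ring
  have hrealc := congrArg (fun x : ℝ => (x : ℂ)) hreal
  push_cast at hrealc
  rw [hsum, Complex.Gamma_one, hlog]
  nth_rewrite 1 [h2]
  rw [← Complex.exp_add]
  congr 1
  push_cast
  linear_combination hrealc

theorem cConst_asymptotics : ∃ R : ℝ → ℂ,
      (∀ m : ℕ, R =O[𝓝[<] (0 : ℝ)] fun h : ℝ => h ^ m) ∧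
      ∀ᶠ h : ℝ in 𝓝[<] (0 : ℝ),
        cConst (Complex.exp h) =
          Complex.exp ((Real.pi : ℂ) ^ 2 / 4 * (h : ℂ)⁻¹ - 1 / 2 * (Real.log (-h) : ℂ)
            + (Real.log (Real.sqrt (4 * Real.pi)) : ℂ) + R h) := by
  set L : ℝ → ℂ := fun h => (Real.pi : ℂ) ^ 2 / 4 * (h : ℂ)⁻¹ - 1 / 2 * (Real.log (-h) : ℂ)
            + (Real.log (Real.sqrt (4 * Real.pi)) : ℂ) with hL
  -- One remainder must serve all `m`. The principal logarithm does: it equals the remainder found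
  -- for a given `m` as soon as that has norm below `1 < π`.
  set R : ℝ → ℂ := fun h => Complex.log (cConst (Complex.exp h) / Complex.exp (L h)) with hR
  have key : ∀ m : ℕ, ∃ C : ℝ, ∀ᶠ h : ℝ in 𝓝[<] (0 : ℝ),
      ‖R h‖ ≤ C * |h| ^ (2 * (m + 1)) ∧ cConst (Complex.exp h) = Complex.exp (L h + R h) := by
    intro m
    obtain ⟨C, δ, hδ, H⟩ := exists_cConst_expansion m
    refine ⟨C, ?_⟩
    have h1 : ∀ᶠ h : ℝ in 𝓝[<] (0 : ℝ), -δ < h :=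
      eventually_nhdsWithin_of_eventually_nhds (eventually_gt_nhds (by linarith))
    have h2 : ∀ᶠ h : ℝ in 𝓝[<] (0 : ℝ), C * |h| ^ (2 * (m + 1)) < 1 := by
      refine eventually_nhdsWithin_of_eventually_nhds ?_
      have hc : Continuous fun h : ℝ => C * |h| ^ (2 * (m + 1)) := by fun_prop
      refine (hc.tendsto 0).eventually_lt_const ?_
      simp
    filter_upwards [h1, h2, self_mem_nhdsWithin] with h hh1 hh2 hh3
    obtain ⟨r, hr, e⟩ := H h hh1 hh3
    have hRr : R h = r := by
      have him : |r.im| < 1 := (Complex.abs_im_le_norm r).trans_lt (hr.trans_lt hh2)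
      rw [abs_lt] at him
      simp only [hR, e]
      rw [Complex.exp_add, mul_div_cancel_left₀ _ (Complex.exp_ne_zero _),
        Complex.log_exp (by linarith [Real.pi_gt_three]) (by linarith [Real.pi_gt_three])]
    rw [hRr]
    exact ⟨hr, e⟩
  refine ⟨R, fun m => ?_, (key 0).elim fun C hC => hC.mono fun h hh => hh.2⟩
  obtain ⟨C, hC⟩ := key m
  refine IsBigO.of_bound |C| ?_
  have h1 : ∀ᶠ h : ℝ in 𝓝[<] (0 : ℝ), -1 < h :=
    eventually_nhdsWithin_of_eventually_nhds (eventually_gt_nhds (by norm_num))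
  filter_upwards [hC, h1, self_mem_nhdsWithin] with h hh hh1 hh0
  have hh0 : h < 0 := hh0
  have habs : |h| ≤ 1 := abs_le.2 ⟨hh1.le, by linarith⟩
  rw [norm_pow, Real.norm_eq_abs]
  calc ‖R h‖ ≤ C * |h| ^ (2 * (m + 1)) := hh.1
    _ ≤ |C| * |h| ^ (2 * (m + 1)) := by gcongr; exact le_abs_self C
    _ ≤ |C| * |h| ^ m := by
      gcongr 1
      exact pow_le_pow_of_le_one (abs_nonneg h) habs (by omega)

/-! ### The `q`-dilogarithm -/

/-- The absolutely convergent double series of `(q ^ j z) ^ (n+1) / (n+1)` is summed in both orders.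
The additive form is needed because the expansion concerns `Li₂(z; q)` itself and not only its
exponential. -/
theorem tendsto_sum_neg_log_qDilog {z q : ℂ} (hz : ‖z‖ < 1) (hq : ‖q‖ < 1) :
    Tendsto (fun N => ∑ j ∈ Finset.range N, -Complex.log (1 - q ^ j * z)) atTop
      (𝓝 (qDilog z q)) := by
  set f : ℕ → ℕ → ℂ := fun n j => (q ^ j * z) ^ (n + 1) / ((n : ℂ) + 1) with hf
  have hqj : ∀ j, ‖q ^ j * z‖ < 1 := fun j => by
    rw [norm_mul, norm_pow]
    exact (mul_le_of_le_one_left (norm_nonneg z) (pow_le_one₀ (norm_nonneg q) hq.le)).trans_lt hz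
  have hsum : Summable fun p : ℕ × ℕ => f p.1 p.2 := by
    have hg := (summable_geometric_of_lt_one (norm_nonneg z) hz).mul_of_nonneg
      (summable_geometric_of_lt_one (norm_nonneg q) hq) (fun n => by positivity)
      (fun n => by positivity)
    refine .of_norm_bounded hg fun p => ?_
    obtain ⟨n, j⟩ := p
    have h1 : (1 : ℝ) ≤ ((n + 1 : ℕ) : ℝ) := by simp
    simp only [hf]
    rw [norm_div, norm_pow, show ((n : ℂ) + 1) = ((n + 1 : ℕ) : ℂ) by push_cast; rfl,
      Complex.norm_natCast]
    refine (div_le_self (by positivity) h1).trans ?_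
    rw [norm_mul, norm_pow, mul_pow, mul_comm, pow_succ ‖z‖, pow_succ (‖q‖ ^ j)]
    have h2 : (‖q‖ ^ j) ^ n ≤ 1 := pow_le_one₀ (by positivity) (pow_le_one₀ (norm_nonneg q) hq.le)
    calc ‖z‖ ^ n * ‖z‖ * ((‖q‖ ^ j) ^ n * ‖q‖ ^ j)
        ≤ ‖z‖ ^ n * 1 * (1 * ‖q‖ ^ j) := by gcongr
      _ = _ := by ring
  have hrow : ∀ n, ∑' j, f n j = z ^ (n + 1) / (((n : ℂ) + 1) * (1 - q ^ (n + 1))) := by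
    intro n
    have hqn : ‖q ^ (n + 1)‖ < 1 := by
      rw [norm_pow]; exact pow_lt_one₀ (norm_nonneg q) hq (Nat.succ_ne_zero n)
    have h1 : ∀ j, f n j = z ^ (n + 1) / ((n : ℂ) + 1) * (q ^ (n + 1)) ^ j := by
      intro j
      simp only [hf]
      ring
    simp only [h1, tsum_mul_left, tsum_geometric_of_norm_lt_one hqn]
    rw [← div_eq_mul_inv, div_div]
  have hcol : ∀ j, ∑' n, f n j = -Complex.log (1 - q ^ j * z) := by
    intro j
    have h := (hasSum_nat_add_iff' 1).2 (Complex.hasSum_taylorSeries_neg_log (hqj j))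
    simp only [Finset.range_one, Finset.sum_singleton, pow_zero, Nat.cast_zero, div_zero,
      sub_zero] at h
    rw [← h.tsum_eq]
    refine tsum_congr fun n => ?_
    simp [hf]
  have hS := hsum.prod_symm.prod
  have hcomm := Summable.tsum_comm (f := f) hsum
  simp only [hrow, hcol] at hcomm
  simp only [hcol, Prod.swap_prod_mk] at hS
  rw [qDilog, ← hcomm]
  exact hS.hasSum.tendsto_sum_nat

theorem qPoch_eq_exp_neg_qDilog {z q : ℂ} (hz : ‖z‖ < 1) (hq : ‖q‖ < 1) :
    qPoch z q = Complex.exp (-qDilog z q) := by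
  refine tendsto_nhds_unique (tendsto_qPoch hq z)
    (((Complex.continuous_exp.tendsto _).comp (tendsto_sum_neg_log_qDilog hz hq).neg).congr
      fun N => ?_)
  simp only [Function.comp_apply, Finset.sum_neg_distrib, neg_neg]
  rw [Complex.exp_sum]
  refine Finset.prod_congr rfl fun j _ => Complex.exp_log fun h => ?_
  have h1 : ‖q ^ j * z‖ < 1 := by
    rw [norm_mul, norm_pow]
    exact (mul_le_of_le_one_left (norm_nonneg z) (pow_le_one₀ (norm_nonneg q) hq.le)).trans_lt hz
  rw [← sub_eq_zero.1 h, norm_one] at h1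
  exact lt_irrefl _ h1

theorem polylog_one_sub {k : ℕ} (hk : 1 ≤ k) (z : ℂ) :
    polylog (1 - (k : ℤ)) z = polylogNonpos (k - 1) z := by
  rw [polylog, if_neg (by omega)]
  congr 1
  omega

theorem sum_Icc_one_succ {E : Type*} [AddCommMonoid E] (T : ℕ → E) (m : ℕ) :
    ∑ k ∈ Finset.Icc 1 (m + 1), T k = T 1 + ∑ k ∈ Finset.Icc 1 m, T (k + 1) := by
  induction m with
  | zero => simp
  | succ m ih =>
    rw [Finset.sum_Icc_succ_top (by omega), ih, Finset.sum_Icc_succ_top (by omega), add_assoc]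

/-- The expansion of `Li₂(ω q ^ a; q)` up to order `m`. -/
noncomputable def qDilogExpansion (m : ℕ) (ω a : ℂ) (h : ℝ) : ℂ :=
  -(polylog 2 ω) * (h : ℂ)⁻¹ + (a - 1 / 2) * Complex.log (1 - ω)
    - ∑ k ∈ Finset.Icc 1 m, bernoulliValue (k + 1) a / (Nat.factorial (k + 1) : ℂ)
      * polylog (1 - (k : ℤ)) ω * (h : ℂ) ^ k

theorem norm_mul_exp_lt_one {ω a : ℂ} (hω : ‖ω‖ = 1) (ha : 0 < a.re) {h : ℝ} (h0 : h < 0) :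
    ‖ω * Complex.exp (a * h)‖ < 1 := by
  rw [norm_mul, hω, one_mul, Complex.norm_exp, Real.exp_lt_one_iff, Complex.re_mul_ofReal]
  exact mul_neg_of_pos_of_neg ha h0

theorem qDilog_sub_expansion_isBigO (m : ℕ) {ω a : ℂ} (hω : ‖ω‖ = 1) (hω1 : ω ≠ 1)
    (ha : 0 < a.re) :
    (fun h : ℝ => qDilog (ω * Complex.exp (a * h)) (Complex.exp h) - qDilogExpansion m ω a h)
      =O[𝓝[<] (0 : ℝ)] fun h : ℝ => h ^ (m + 1) := by
  -- Order `m + 1` is right: the Euler–Maclaurin term `k = 1` is the constant `log (1 - ω)` term,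
  -- and term `k + 1` carries `h ^ k`.
  obtain ⟨B, δ, hB, hδ, H⟩ := exists_sum_logOneSubExp_expansion hω hω1
    (M := m + 1) (by omega) ‖a‖
  refine IsBigO.of_bound B ?_
  have h1 : ∀ᶠ h : ℝ in 𝓝[<] (0 : ℝ), -δ < h :=
    eventually_nhdsWithin_of_eventually_nhds (eventually_gt_nhds (by linarith))
  filter_upwards [h1, self_mem_nhdsWithin] with h hhδ h0
  have h0 : h < 0 := h0
  obtain ⟨r, hr, hlim⟩ := H (-h) (by linarith) (by linarith) a le_rfl
  have hdl := (tendsto_sum_neg_log_qDilog (norm_mul_exp_lt_one hω ha h0)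
    (norm_exp_ofReal_lt_one h0)).neg
  have hterm : ∀ N : ℕ, -∑ j ∈ Finset.range N,
      -Complex.log (1 - Complex.exp h ^ j * (ω * Complex.exp (a * h)))
      = ∑ j ∈ Finset.range N, logOneSubExp ω ((a + j) * ((-h : ℝ) : ℂ)) := by
    intro N
    rw [Finset.sum_neg_distrib, neg_neg]
    refine Finset.sum_congr rfl fun j _ => ?_
    rw [logOneSubExp, mul_left_comm, ← Complex.exp_nat_mul, ← Complex.exp_add]
    congr 4
    push_cast
    ring
  have hlim2 := (hdl.congr hterm).sub hlim
  simp only [sub_sub_cancel] at hlim2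
  have hbound := le_of_tendsto hlim2.norm (Eventually.of_forall hr)
  have hmain : -(((-h : ℝ) : ℂ)⁻¹ * polylog 2 ω) - ∑ k ∈ Finset.Icc 1 (m + 1),
          bernoulliValue k a / (k.factorial : ℂ) * ((-h : ℝ) : ℂ) ^ (k - 1)
            * iteratedDeriv (k - 1) (logOneSubExp ω) 0 = -qDilogExpansion m ω a h := by
    have hs : ∀ k ∈ Finset.Icc 1 m,
        bernoulliValue (k + 1) a / ((k + 1).factorial : ℂ) * ((-h : ℝ) : ℂ) ^ (k + 1 - 1)
            * iteratedDeriv (k + 1 - 1) (logOneSubExp ω) 0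
        = -(bernoulliValue (k + 1) a / (Nat.factorial (k + 1) : ℂ)
          * polylog (1 - (k : ℤ)) ω * (h : ℂ) ^ k) := by
      intro k hk
      obtain ⟨n, rfl⟩ : ∃ n, k = n + 1 := ⟨k - 1, by have := (Finset.mem_Icc.1 hk).1; omega⟩
      rw [polylog_one_sub (by omega), Nat.add_sub_cancel, Nat.add_sub_cancel,
        iteratedDeriv_logOneSubExp_zero hω hω1, Complex.ofReal_neg, neg_pow]
      have : (-1 : ℂ) ^ (n + 1) * (-1) ^ n = -1 := by
        rw [← pow_add, show n + 1 + n = 2 * n + 1 by ring, pow_succ, pow_mul]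
        simp
      linear_combination (bernoulliValue (n + 1 + 1) a / ((n + 1 + 1).factorial : ℂ)
        * (h : ℂ) ^ (n + 1) * polylogNonpos n ω) * this
    rw [sum_Icc_one_succ, Finset.sum_congr rfl hs, Finset.sum_neg_distrib, qDilogExpansion]
    simp only [bernoulliValue_one, Nat.factorial_one, Nat.cast_one, div_one, Nat.sub_self, pow_zero,
      mul_one, iteratedDeriv_zero, logOneSubExp, neg_zero, Complex.exp_zero, Complex.ofReal_neg,
      inv_neg]
    ring
  rw [hmain] at hbound
  rw [norm_pow, Real.norm_eq_abs, abs_of_neg h0]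
  rwa [← norm_neg, neg_sub']

/-! ### Inversion and duplication for polylogarithms of non-positive index -/

/-- Inversion changes the sign of `z d/dz`; the constant present for `Li₀` disappears at the first
differentiation. -/
theorem polylogNonpos_inv (n : ℕ) : ∀ z : ℂ, z ≠ 0 → z ≠ 1 →
    polylogNonpos n z⁻¹ = (-1) ^ (n + 1) * polylogNonpos n z - if n = 0 then 1 else 0 := by
  induction n with
  | zero =>
    intro z h0 h1
    have h2 : 1 - z ≠ 0 := sub_ne_zero.2 h1.symm
    have h3 : z - 1 ≠ 0 := sub_ne_zero.2 h1
    simp only [polylogNonpos, if_true]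
    field_simp
    ring
  | succ n ih =>
    intro z h0 h1
    have h1' : z⁻¹ ≠ 1 := fun h => h1 (inv_eq_one.1 h)
    have hev : (fun z => polylogNonpos n z⁻¹) =ᶠ[𝓝 z]
        fun z => (-1) ^ (n + 1) * polylogNonpos n z - if n = 0 then 1 else 0 := by
      filter_upwards [isOpen_ne.mem_nhds h0, isOpen_ne.mem_nhds h1] with w hw0 hw1
      exact ih w hw0 hw1
    have e1 : HasDerivAt (fun z => polylogNonpos n z⁻¹)
        (deriv (polylogNonpos n) z⁻¹ * (-(z ^ 2)⁻¹)) z :=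
      (analyticAt_polylogNonpos n h1').differentiableAt.hasDerivAt.comp z (hasDerivAt_inv h0)
    have e2 : HasDerivAt (fun z => (-1) ^ (n + 1) * polylogNonpos n z - if n = 0 then 1 else 0)
        ((-1) ^ (n + 1) * deriv (polylogNonpos n) z) z :=
      ((analyticAt_polylogNonpos n h1).differentiableAt.hasDerivAt.const_mul _).sub_const _
    have e3 := (e1.congr_of_eventuallyEq hev.symm).unique e2
    simp only [polylogNonpos, if_neg (Nat.succ_ne_zero n), sub_zero]
    rw [pow_succ (-1 : ℂ), show (-1 : ℂ) ^ (n + 1) * -1 * (z * deriv (polylogNonpos n) z)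
      = -z * ((-1 : ℂ) ^ (n + 1) * deriv (polylogNonpos n) z) by ring, ← e3]
    field_simp

/-- Partial fractions for `Li₀`; each application of `z d/dz` to a function of `z ^ 2` then adds a
factor `2`. -/
theorem polylogNonpos_add_neg (n : ℕ) : ∀ z : ℂ, z ≠ 1 → z ≠ -1 →
    polylogNonpos n z + polylogNonpos n (-z) = 2 ^ (n + 1) * polylogNonpos n (z ^ 2) := by
  induction n with
  | zero =>
    intro z h1 h2
    have h3 : 1 - z ≠ 0 := sub_ne_zero.2 h1.symm
    have h4 : 1 + z ≠ 0 := fun h => h2 (eq_neg_of_add_eq_zero_right h)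
    have h5 : 1 - z ^ 2 ≠ 0 := by
      rw [show 1 - z ^ 2 = (1 - z) * (1 + z) by ring]
      exact mul_ne_zero h3 h4
    simp only [polylogNonpos, sub_neg_eq_add]
    field_simp
    ring
  | succ n ih =>
    intro z h1 h2
    have h3 : -z ≠ 1 := fun h => h2 (neg_eq_iff_eq_neg.1 h)
    have h4 : z ^ 2 ≠ 1 := fun h =>
      (sq_eq_sq_iff_eq_or_eq_neg.1 (h.trans (one_pow 2).symm)).elim h1 h2
    have hev : (fun z => polylogNonpos n z + polylogNonpos n (-z)) =ᶠ[𝓝 z]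
        fun z => 2 ^ (n + 1) * polylogNonpos n (z ^ 2) := by
      filter_upwards [isOpen_ne.mem_nhds h1, isOpen_ne.mem_nhds h2] with w hw0 hw1
      exact ih w hw0 hw1
    have e1 : HasDerivAt (fun z => polylogNonpos n z + polylogNonpos n (-z))
        (deriv (polylogNonpos n) z + deriv (polylogNonpos n) (-z) * -1) z :=
      (analyticAt_polylogNonpos n h1).differentiableAt.hasDerivAt.add
        ((analyticAt_polylogNonpos n h3).differentiableAt.hasDerivAt.comp z (hasDerivAt_neg z))
    have e2 : HasDerivAt (fun z => 2 ^ (n + 1) * polylogNonpos n (z ^ 2))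
        (2 ^ (n + 1) * (deriv (polylogNonpos n) (z ^ 2) * (((2 : ℕ) : ℂ) * z ^ (2 - 1)))) z :=
      ((analyticAt_polylogNonpos n h4).differentiableAt.hasDerivAt.comp z
        (hasDerivAt_pow 2 z)).const_mul _
    have e3 := (e1.congr_of_eventuallyEq hev.symm).unique e2
    simp only [polylogNonpos]
    linear_combination z * e3

/-! ### The dilogarithm on the unit circle -/

/-- The derivative `log (1 - ω e⁻ᶻ)` of `Li₂(ω e⁻ᶻ)` on `Re z > 0` extends continuously to `0`.
Hence the function is differentiable at `0` within the closed half plane, in particular along the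
imaginary axis. -/
theorem hasDerivAt_dilog_circle {ω : ℂ} (hω : ‖ω‖ = 1) (hω1 : ω ≠ 1) :
    HasDerivAt (fun y : ℝ => polylog 2 (ω * Complex.exp (-(y * Complex.I))))
      (Complex.log (1 - ω) * Complex.I) 0 := by
  set s : Set ℂ := {z | 0 < z.re} with hs
  have hsc : closure s = {z | 0 ≤ z.re} := Complex.closure_setOfPred_lt_re 0
  set F : ℂ → ℂ := fun z => polylog 2 (ω * Complex.exp (-z)) with hF
  have hd : ∀ z ∈ s, HasFDerivAt F (logOneSubExp ω z • (1 : ℂ →L[ℝ] ℂ)) z := fun z hz =>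
    (hasDerivAt_dilog_exp hω hz).complexToReal_fderiv
  have hslit : 1 - ω * Complex.exp (-0) ∈ Complex.slitPlane := by
    obtain ⟨σ, hσ0, _, h⟩ := exists_strip_mem_slitPlane hω hω1
    exact h 0 (by simpa using ofReal_mem_rayStrip hσ0 le_rfl)
  have hc : ContinuousAt (logOneSubExp ω) 0 := (hasDerivAt_logOneSubExp hslit).continuousAt
  have key : HasFDerivWithinAt F (logOneSubExp ω 0 • (1 : ℂ →L[ℝ] ℂ)) (closure s) 0 := by
    refine hasFDerivWithinAt_closure_of_tendsto_fderiv
      (fun z hz => (hd z hz).differentiableAt.differentiableWithinAt)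
      (convex_halfSpace_re_gt 0) (isOpen_lt continuous_const Complex.continuous_re) ?_ ?_
    · intro y hy
      rw [hsc] at hy
      exact (continuousOn_dilog_exp hω y hy).mono fun z (hz : 0 < z.re) => hz.le
    · have h1 : Tendsto (fun z => logOneSubExp ω z • (1 : ℂ →L[ℝ] ℂ)) (𝓝[s] 0)
          (𝓝 (logOneSubExp ω 0 • (1 : ℂ →L[ℝ] ℂ))) :=
        (hc.tendsto.mono_left nhdsWithin_le_nhds).smul_const _
      refine h1.congr' ?_
      filter_upwards [self_mem_nhdsWithin] with z hz
      exact (hd z hz).fderiv.symm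
  have hcurve : HasDerivAt (fun y : ℝ => (y : ℂ) * Complex.I) (1 * Complex.I) (0 : ℝ) :=
    (Complex.ofRealCLM.hasDerivAt (x := (0 : ℝ))).mul_const Complex.I
  have h0 : (fun y : ℝ => (y : ℂ) * Complex.I) 0 = 0 := by simp
  rw [← h0] at key
  have := key.comp_hasDerivWithinAt (s := Set.univ) (0 : ℝ) hcurve.hasDerivWithinAt (by
    intro y _
    rw [hsc]
    simp)
  rw [hasDerivWithinAt_univ] at this
  refine this.congr_deriv ?_
  simp [logOneSubExp]

/-- `(1 - ω)(1 + ω⁻¹) = -2i Im ω`, and both factors have positive real part, so their principal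
logarithms add. -/
theorem log_one_sub_add_log_one_add_inv {ω : ℂ} (hω : ‖ω‖ = 1) (him : ω.im ≠ 0) :
    Complex.log (1 - ω) + Complex.log (1 + ω⁻¹)
      = (Real.log |2 * ω.im| : ℂ) - Complex.I * ((Real.pi : ℂ) / 2) * (Real.sign ω.im : ℂ) := by
  have hsq : ω.re ^ 2 + ω.im ^ 2 = 1 := by
    have := Complex.sq_norm ω
    rw [hω, Complex.normSq_apply] at this
    linarith
  have him2 : 0 < ω.im ^ 2 := by positivity
  have hinv : ω⁻¹ = (starRingEnd ℂ) ω := by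
    rw [Complex.inv_def, Complex.normSq_eq_norm_sq, hω]
    simp
  have hu : 0 < (1 - ω).re := by simp; nlinarith
  have hv : 0 < (1 + ω⁻¹).re := by rw [hinv]; simp; nlinarith
  have hu0 : 1 - ω ≠ 0 := fun h => by rw [h] at hu; simp at hu
  have hv0 : 1 + ω⁻¹ ≠ 0 := fun h => by rw [h] at hv; simp at hv
  have hau := Complex.abs_arg_lt_pi_div_two_iff.2 (Or.inl hu)
  have hav := Complex.abs_arg_lt_pi_div_two_iff.2 (Or.inl hv)
  rw [abs_lt] at hau hav
  rw [← Complex.log_mul hu0 hv0 ⟨by linarith, by linarith⟩]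
  have hprod : (1 - ω) * (1 + ω⁻¹) = ((2 * ω.im : ℝ) : ℂ) * (-Complex.I) := by
    rw [hinv]
    apply Complex.ext
    · simp
      linarith
    · simp
      ring
  rw [hprod]
  rcases lt_or_gt_of_ne him with h | h
  · rw [show ((2 * ω.im : ℝ) : ℂ) * (-Complex.I) = ((|2 * ω.im| : ℝ) : ℂ) * Complex.I by
      rw [abs_of_neg (by linarith)]; push_cast; ring,
      Complex.log_ofReal_mul (by positivity) Complex.I_ne_zero, Complex.log_I, Real.sign_of_neg h]
    push_cast
    ring
  · rw [abs_of_pos (by linarith), Complex.log_ofReal_mul (by positivity)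
      (neg_ne_zero.2 Complex.I_ne_zero), Complex.log_neg_I, Real.sign_of_pos h]
    push_cast
    ring

/-- `Li₂(e^{iθ}) - Li₂(-e^{-iθ})` for `0 ≤ θ < π`. -/
theorem dilog_sub_dilog_exp {θ : ℝ} (h0 : 0 ≤ θ) (hπ : θ < Real.pi) :
    polylog 2 (Complex.exp (θ * Complex.I)) - polylog 2 (-(Complex.exp (θ * Complex.I))⁻¹)
      = (Real.pi : ℂ) ^ 2 / 4 - (Real.pi : ℂ) / 2 * θ + Complex.I * (lobachevsky θ : ℂ) := by
  set D : ℝ → ℂ := fun θ => polylog 2 (Complex.exp (θ * Complex.I))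
    - polylog 2 (-(Complex.exp (θ * Complex.I))⁻¹) with hD
  have hcont : Continuous D := by
    refine Continuous.sub ?_ ?_
    · refine continuousOn_dilog.comp_continuous (by fun_prop) fun x => ?_
      simp [Complex.norm_exp_ofReal_mul_I]
    · refine continuousOn_dilog.comp_continuous ?_ fun x => ?_
      · exact (Continuous.inv₀ (by fun_prop) fun x => Complex.exp_ne_zero _).neg
      · simp [Complex.norm_exp_ofReal_mul_I]
  have hderiv : ∀ x ∈ Set.Ioo (0 : ℝ) θ, HasDerivAt D
      (-((Real.pi : ℂ) / 2) - Complex.I * (Real.log |2 * Real.sin x| : ℂ)) x := by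
    intro x hx
    have hsin : 0 < Real.sin x := Real.sin_pos_of_pos_of_lt_pi hx.1 (hx.2.trans hπ)
    set ω := Complex.exp (x * Complex.I) with hωdef
    have hω : ‖ω‖ = 1 := Complex.norm_exp_ofReal_mul_I x
    have him : ω.im = Real.sin x := Complex.exp_ofReal_mul_I_im x
    have hω1 : ω ≠ 1 := fun h => by rw [h] at him; simp at him; linarith
    have hω2 : -ω⁻¹ ≠ 1 := fun h => by
      have h3 : ω = -1 := by rw [← inv_inv ω, ← neg_neg ω⁻¹, h]; norm_num
      rw [h3] at him; simp at him; linarith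
    have hω2n : ‖-ω⁻¹‖ = 1 := by rw [norm_neg, norm_inv, hω, inv_one]
    have e1 := hasDerivAt_dilog_circle hω hω1
    have e2 := hasDerivAt_dilog_circle hω2n hω2
    have e1' : HasDerivAt (fun y : ℝ => polylog 2 (Complex.exp (y * Complex.I)))
        ((-1 : ℝ) • (Complex.log (1 - ω) * Complex.I)) x := by
      have hl : HasDerivAt (fun y : ℝ => x - y) (-1) x := (hasDerivAt_id x).const_sub x
      refine (HasDerivAt.scomp_of_eq x e1 hl (sub_self x).symm).congr_of_eventuallyEq
        (Eventually.of_forall fun y => ?_)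
      simp only [Function.comp_apply, hωdef]
      rw [← Complex.exp_add]
      congr 2
      push_cast
      ring
    have e2' : HasDerivAt (fun y : ℝ => polylog 2 (-(Complex.exp (y * Complex.I))⁻¹))
        ((1 : ℝ) • (Complex.log (1 - -ω⁻¹) * Complex.I)) x := by
      have hl : HasDerivAt (fun y : ℝ => y - x) 1 x := (hasDerivAt_id x).sub_const x
      refine (HasDerivAt.scomp_of_eq x e2 hl (sub_self x).symm).congr_of_eventuallyEq
        (Eventually.of_forall fun y => ?_)
      simp only [Function.comp_apply, hωdef]
      rw [← Complex.exp_neg, ← Complex.exp_neg, neg_mul, ← Complex.exp_add]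
      congr 3
      push_cast
      ring
    refine (e1'.sub e2').congr_deriv ?_
    have hlog := log_one_sub_add_log_one_add_inv hω (by rw [him]; exact hsin.ne')
    rw [him, Real.sign_of_pos hsin] at hlog
    rw [sub_neg_eq_add]
    simp only [neg_smul, one_smul]
    push_cast at hlog
    linear_combination (-Complex.I) * hlog + ((Real.pi : ℂ) / 2) * Complex.I_sq
  have hint : IntervalIntegrable (fun x : ℝ => (Real.log |2 * Real.sin x| : ℂ))
      MeasureTheory.volume 0 θ := 
    ⟨(intervalIntegrable_log_two_sin 0 θ).1.ofReal, (intervalIntegrable_log_two_sin 0 θ).2.ofReal⟩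
  -- The derivative has an integrable logarithmic singularity at `0`; continuity of `D` there is
  -- enough.
  have hftc := intervalIntegral.integral_eq_sub_of_hasDeriv_right_of_le h0 hcont.continuousOn
    (fun x hx => (hderiv x hx).hasDerivWithinAt)
    ((intervalIntegrable_const).sub (hint.const_mul Complex.I))
  rw [intervalIntegral.integral_sub intervalIntegrable_const (hint.const_mul _),
    intervalIntegral.integral_const, intervalIntegral.integral_const_mul,
    intervalIntegral.integral_ofReal] at hftc
  have hD0 : D 0 = (Real.pi : ℂ) ^ 2 / 4 := by
    simp only [hD, Complex.ofReal_zero, zero_mul, Complex.exp_zero, inv_one, dilog_one,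
      dilog_neg_one]
    ring
  rw [hD0] at hftc
  have hlob : (lobachevsky θ : ℂ) = -((∫ x in (0 : ℝ)..θ, Real.log |2 * Real.sin x| : ℝ) : ℂ) := by
    rw [lobachevsky, Complex.ofReal_neg]
  rw [hlob]
  change D θ = _
  simp only [sub_zero, Complex.real_smul] at hftc
  linear_combination -hftc

theorem dilog_conj (z : ℂ) : polylog 2 ((starRingEnd ℂ) z) = (starRingEnd ℂ) (polylog 2 z) := by
  rw [polylog_two, polylog_two, Complex.conj_tsum]
  refine tsum_congr fun n => ?_
  simp

theorem lobachevsky_neg (θ : ℝ) : lobachevsky (-θ) = -lobachevsky θ := by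
  rw [lobachevsky, lobachevsky]
  have h := intervalIntegral.integral_comp_neg (a := 0) (b := θ)
    fun x : ℝ => Real.log |2 * Real.sin x|
  simp only [Real.sin_neg, mul_neg, abs_neg, neg_zero] at h
  rw [h, ← intervalIntegral.integral_symm, neg_neg]

/-- The lower half circle follows from the upper by complex conjugation, as the Lobachevsky function
is odd. -/
theorem dilog_sub_dilog_neg_inv {ω : ℂ} (hω : ‖ω‖ = 1) (him : ω.im ≠ 0) :
    polylog 2 ω - polylog 2 (-ω⁻¹) = (Real.pi : ℂ) ^ 2 / 4
      - (Real.pi : ℂ) / 2 * (|Complex.arg ω| : ℝ) + Complex.I * (circleLobachevsky ω : ℂ) := by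
  have hpos : ∀ ω : ℂ, ‖ω‖ = 1 → 0 < ω.im →
      polylog 2 ω - polylog 2 (-ω⁻¹) = (Real.pi : ℂ) ^ 2 / 4
        - (Real.pi : ℂ) / 2 * (|Complex.arg ω| : ℝ) + Complex.I * (circleLobachevsky ω : ℂ) := by
    intro ω hω him
    have harg0 : 0 ≤ ω.arg := Complex.arg_nonneg_iff.2 him.le
    have hargπ : ω.arg < Real.pi := lt_of_le_of_ne (Complex.arg_le_pi ω) fun h => by
      rw [Complex.arg_eq_pi_iff] at h
      exact him.ne' h.2
    have h := dilog_sub_dilog_exp harg0 hargπ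
    have hωe : Complex.exp (ω.arg * Complex.I) = ω := by
      have := Complex.norm_mul_exp_arg_mul_I ω
      rwa [hω, Complex.ofReal_one, one_mul] at this
    rw [hωe] at h
    rw [h, abs_of_nonneg harg0, circleLobachevsky]
  rcases lt_or_gt_of_ne him with h | h
  · have hc := hpos ((starRingEnd ℂ) ω) (by simpa using hω) (by simpa using h)
    have hargne : ω.arg ≠ Real.pi := fun h' => by
      rw [Complex.arg_eq_pi_iff] at h'
      exact him h'.2
    have harg : ((starRingEnd ℂ) ω).arg = -ω.arg := by rw [Complex.arg_conj, if_neg hargne]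
    have hc2 := congrArg (starRingEnd ℂ) hc
    rw [← map_inv₀, ← map_neg, dilog_conj, dilog_conj, circleLobachevsky, harg, abs_neg,
      lobachevsky_neg] at hc2
    simp only [map_sub, map_add, map_mul, map_div₀, map_pow, Complex.conj_conj, Complex.conj_ofReal,
      Complex.conj_I, map_ofNat] at hc2
    rw [hc2, circleLobachevsky]
    push_cast
    ring
  · exact hpos ω hω h

/-! ### `G_q` at `ω q ^ a` -/

/-- For `k ≥ 2`, inversion replaces `-ω⁻¹` by `-ω`, its sign combines with that of `B_{k+1}(1-a)` so
that the two terms add, and duplication turns them into `2^k Li_{1-k}(ω²)`. -/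
theorem qDilogExpansion_sub {m : ℕ} (hm : 1 ≤ m) {ω : ℂ} (hω : ‖ω‖ = 1) (him : ω.im ≠ 0) (a : ℂ)
    (h : ℝ) :
    qDilogExpansion m ω a h - qDilogExpansion m (-ω⁻¹) (1 - a) h
      = ((Real.pi : ℂ) / 2 * (|Complex.arg ω| : ℝ) - (Real.pi : ℂ) ^ 2 / 4
                - Complex.I * (circleLobachevsky ω : ℂ)) * (h : ℂ)⁻¹
              + ((a : ℂ) - 1 / 2) * ((Real.log |2 * ω.im| : ℂ)
                - Complex.I * ((Real.pi : ℂ) / 2) * (Real.sign ω.im : ℂ))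
              + bernoulliValue 2 a * (ω.re : ℂ) / (2 * Complex.I * (ω.im : ℂ)) * (h : ℂ)
              - ∑ k ∈ Finset.Icc 2 m,
                  2 ^ k * bernoulliValue (k + 1) a / (Nat.factorial (k + 1) : ℂ)
                    * polylog (1 - (k : ℤ)) (ω ^ 2) * (h : ℂ) ^ k := by
  have hω0 : ω ≠ 0 := fun h => by simp [h] at hω
  have hω1 : ω ≠ 1 := fun h => by simp [h] at him
  have hω2 : ω ≠ -1 := fun h => by simp [h] at him
  have hω1' : -ω ≠ 1 := fun h => hω2 (neg_eq_iff_eq_neg.1 h)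
  have hω0' : -ω ≠ 0 := neg_ne_zero.2 hω0
  have e1 := dilog_sub_dilog_neg_inv hω him
  have e2 := log_one_sub_add_log_one_add_inv hω him
  have hsum : ∀ k ∈ Finset.Icc 2 m,
      bernoulliValue (k + 1) a / (Nat.factorial (k + 1) : ℂ)
          * polylog (1 - (k : ℤ)) ω * (h : ℂ) ^ k
        - bernoulliValue (k + 1) (1 - a) / (Nat.factorial (k + 1) : ℂ)
          * polylog (1 - (k : ℤ)) (-ω⁻¹) * (h : ℂ) ^ k
      = 2 ^ k * bernoulliValue (k + 1) a / (Nat.factorial (k + 1) : ℂ)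
          * polylog (1 - (k : ℤ)) (ω ^ 2) * (h : ℂ) ^ k := by
    intro k hk
    have hk2 := (Finset.mem_Icc.1 hk).1
    obtain ⟨n, rfl⟩ : ∃ n, k = n + 1 + 1 := ⟨k - 2, by omega⟩
    simp only [polylog_one_sub (show 1 ≤ n + 1 + 1 by omega), Nat.add_sub_cancel]
    have h1 := polylogNonpos_inv (n + 1) (-ω) hω0' hω1'
    have h2 := polylogNonpos_add_neg (n + 1) ω hω1 hω2
    rw [inv_neg, if_neg (Nat.succ_ne_zero n), sub_zero] at h1
    rw [bernoulliValue_one_sub, h1]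
    have h3 : (-1 : ℂ) ^ (n + 1 + 1 + 1) * (-1) ^ (n + 1 + 1) = -1 := by
      rw [← pow_add, show n + 1 + 1 + 1 + (n + 1 + 1) = 2 * (n + 2) + 1 by ring, pow_succ, pow_mul]
      simp
    linear_combination (bernoulliValue (n + 1 + 1 + 1) a / ((n + 1 + 1 + 1).factorial : ℂ)
      * (h : ℂ) ^ (n + 1 + 1)) * (h2 - polylogNonpos (n + 1) (-ω) * h3)
  have hinv : ω⁻¹ = (starRingEnd ℂ) ω := by
    rw [Complex.inv_def, Complex.normSq_eq_norm_sq, hω]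
    simp
  -- Inversion of `Li₀` carries a constant, so the term `k = 1` is computed directly from `2 Re ω =
  -- ω + ω⁻¹` and `2i Im ω = ω - ω⁻¹`.
  have hone : bernoulliValue 2 a / (Nat.factorial 2 : ℂ) * polylogNonpos 0 ω
      - bernoulliValue 2 (1 - a) / (Nat.factorial 2 : ℂ) * polylogNonpos 0 (-ω⁻¹)
      = -(bernoulliValue 2 a * (ω.re : ℂ) / (2 * Complex.I * (ω.im : ℂ))) := by
    have h3 : 1 - ω ≠ 0 := sub_ne_zero.2 hω1.symm
    have h4 : 1 + ω ≠ 0 := fun h => hω2 (eq_neg_of_add_eq_zero_right h)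
    have h5 : ω + 1 ≠ 0 := by rwa [add_comm]
    have him' : (ω.im : ℂ) ≠ 0 := by exact_mod_cast him
    have hre2 : 2 * (ω.re : ℂ) = ω + ω⁻¹ := by
      rw [hinv, Complex.add_conj]
      push_cast
      ring
    have him2 : 2 * Complex.I * (ω.im : ℂ) = ω - ω⁻¹ := by
      rw [hinv, Complex.sub_conj]
      push_cast
      ring
    have h6 : ω ^ 2 - 1 ≠ 0 := by
      rw [show ω ^ 2 - 1 = -((1 - ω) * (1 + ω)) by ring]
      exact neg_ne_zero.2 (mul_ne_zero h3 h4)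
    rw [bernoulliValue_one_sub, him2, show (ω.re : ℂ) = (ω + ω⁻¹) / 2 by rw [← hre2]; ring]
    have h7 : 1 - -ω⁻¹ = (ω + 1) / ω := by field_simp; ring
    have h8 : ω - ω⁻¹ = (ω ^ 2 - 1) / ω := by field_simp
    simp only [polylogNonpos]
    rw [h7, h8, Nat.factorial_two]
    push_cast
    field_simp
    ring
  have hIcc : ∀ T : ℕ → ℂ, ∑ k ∈ Finset.Icc 1 m, T k = T 1 + ∑ k ∈ Finset.Icc 2 m, T k := by
    intro T
    rw [← Finset.add_sum_Ioc_eq_sum_Icc hm]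
    rfl
  rw [qDilogExpansion, qDilogExpansion, hIcc, hIcc, ← Finset.sum_congr rfl hsum,
    Finset.sum_sub_distrib, polylog_one_sub le_rfl, polylog_one_sub le_rfl, Nat.sub_self, pow_one,
    sub_neg_eq_add]
  rw [show 1 + 1 = 2 from rfl]
  linear_combination (-(h : ℂ)⁻¹) * e1 + (a - 1 / 2) * e2 - (h : ℂ) * hone

theorem Gfun_circle_asymptotics_of_one_le {m : ℕ} (hm : 1 ≤ m) {ω : ℂ} (hω : ‖ω‖ = 1)
    (him : ω.im ≠ 0) {a : ℝ} (ha0 : 0 < a) (ha1 : a < 1) :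
    ∃ R : ℝ → ℂ, (R =O[𝓝[<] (0 : ℝ)] fun h : ℝ => h ^ (m + 1)) ∧
        ∀ᶠ h : ℝ in 𝓝[<] (0 : ℝ),
          Gfun (Complex.exp h) (ω * Complex.exp ((a : ℂ) * h)) =
            Complex.exp (((Real.pi : ℂ) / 2 * (|Complex.arg ω| : ℝ) - (Real.pi : ℂ) ^ 2 / 4
                - Complex.I * (circleLobachevsky ω : ℂ)) * (h : ℂ)⁻¹
              + ((a : ℂ) - 1 / 2) * ((Real.log |2 * ω.im| : ℂ)
                - Complex.I * ((Real.pi : ℂ) / 2) * (Real.sign ω.im : ℂ))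
              + bernoulliValue 2 a * (ω.re : ℂ) / (2 * Complex.I * (ω.im : ℂ)) * (h : ℂ)
              - ∑ k ∈ Finset.Icc 2 m,
                  2 ^ k * bernoulliValue (k + 1) a / (Nat.factorial (k + 1) : ℂ)
                    * polylog (1 - (k : ℤ)) (ω ^ 2) * (h : ℂ) ^ k
              + R h) := by
  have hω0 : ω ≠ 0 := fun h => by simp [h] at hω
  have hω1 : ω ≠ 1 := fun h => by simp [h] at him
  have hω2 : -ω⁻¹ ≠ 1 := fun h => him (by
    rw [← inv_inv ω, ← neg_neg ω⁻¹, h]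
    norm_num)
  have hω2n : ‖-ω⁻¹‖ = 1 := by rw [norm_neg, norm_inv, hω, inv_one]
  -- `0 < a < 1` puts both `ω q ^ a` and `-ω⁻¹ q ^ (1-a)` in the open unit disc, where the
  -- `q`-dilogarithm series converges.
  have hre : 0 < (a : ℂ).re := by simpa using ha0
  have hre' : 0 < (1 - (a : ℂ)).re := by simpa using ha1
  refine ⟨_, (qDilog_sub_expansion_isBigO m hω hω1 hre).sub
    (qDilog_sub_expansion_isBigO m hω2n hω2 hre'), ?_⟩
  filter_upwards [self_mem_nhdsWithin] with h h0
  have h0 : h < 0 := h0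
  have hz : -Complex.exp h * (ω * Complex.exp ((a : ℂ) * h))⁻¹
      = -ω⁻¹ * Complex.exp ((1 - (a : ℂ)) * h) := by
    rw [mul_inv, ← Complex.exp_neg, show (1 - (a : ℂ)) * h = h + -(a * h) by ring, Complex.exp_add]
    ring
  rw [Gfun, hz, qPoch_eq_exp_neg_qDilog (norm_mul_exp_lt_one hω hre h0) (norm_exp_ofReal_lt_one h0),
    qPoch_eq_exp_neg_qDilog (norm_mul_exp_lt_one hω2n hre' h0) (norm_exp_ofReal_lt_one h0),
    ← Complex.exp_sub, ← qDilogExpansion_sub hm hω him]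
  congr 1
  ring

/-! ### Assembly of the expansions -/

theorem mainTheorem7 :
    -- expansion of the normalising constant
    (∃ R : ℝ → ℂ,
      (∀ m : ℕ, R =O[𝓝[<] (0 : ℝ)] fun h : ℝ => h ^ m) ∧
      ∀ᶠ h : ℝ in 𝓝[<] (0 : ℝ),
        cConst (Complex.exp h) =
          Complex.exp ((Real.pi : ℂ) ^ 2 / 4 * (h : ℂ)⁻¹ - 1 / 2 * (Real.log (-h) : ℂ)
            + (Real.log (Real.sqrt (4 * Real.pi)) : ℂ) + R h)) ∧
    -- expansion of `G_q(q ^ a)`, uniformly for `a` in compact sets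
    (∀ (m : ℕ) (K : Set ℂ), IsCompact K → ∃ C δ : ℝ, 0 < δ ∧
      ∀ h : ℝ, -δ < h → h < 0 → ∀ a ∈ K, (∀ n : ℕ, a ≠ -(n : ℂ)) →
        ∃ R : ℂ, ‖R‖ ≤ C * |h| ^ (2 * (m + 1)) ∧
          Gfun (Complex.exp h) (Complex.exp (a * h)) =
            Complex.exp (-((Real.pi : ℂ) ^ 2 / 4) * (h : ℂ)⁻¹
              + (a - 1 / 2) * (Real.log (-h) : ℂ)
              + Complex.log (Complex.Gamma a / (Real.sqrt (2 * Real.pi) : ℂ))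
              + (a - 1 / 2) * (Real.log 2 : ℂ)
              + ∑ k ∈ Finset.Icc 1 m,
                  ((bernoulli (2 * k) : ℚ) : ℂ) * bernoulliValue (2 * k + 1) a
                    / (2 * (k : ℂ) * (Nat.factorial (2 * k + 1) : ℂ))
                    * 2 ^ (2 * k) * (h : ℂ) ^ (2 * k)
              + R)) ∧
    -- expansion of `G_q(-q ^ a)`, uniformly for `a` in compact sets
    (∀ (m : ℕ) (K : Set ℂ), IsCompact K → ∃ C δ : ℝ, 0 < δ ∧
      ∀ h : ℝ, -δ < h → h < 0 → ∀ a ∈ K, (∀ n : ℕ, a ≠ (n : ℂ) + 1) →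
        ∃ R : ℂ, ‖R‖ ≤ C * |h| ^ (2 * (m + 1)) ∧
          Gfun (Complex.exp h) (-Complex.exp (a * h)) =
            Complex.exp ((Real.pi : ℂ) ^ 2 / 4 * (h : ℂ)⁻¹
              + (a - 1 / 2) * (Real.log (-h) : ℂ)
              - Complex.log (Complex.Gamma (1 - a) / (Real.sqrt (2 * Real.pi) : ℂ))
              + (a - 1 / 2) * (Real.log 2 : ℂ)
              + ∑ k ∈ Finset.Icc 1 m,
                  ((bernoulli (2 * k) : ℚ) : ℂ) * bernoulliValue (2 * k + 1) a
                    / (2 * (k : ℂ) * (Nat.factorial (2 * k + 1) : ℂ))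
                    * 2 ^ (2 * k) * (h : ℂ) ^ (2 * k)
              + R)) ∧
    -- the zeros `a = 1, 2, 3, …` of `1 / Γ(1 - a)`, where the preceding expansion reads `0`
    (∀ (n : ℕ) (h : ℝ), h < 0 →
      Gfun (Complex.exp h) (-Complex.exp (((n : ℂ) + 1) * h)) = 0) ∧
    -- expansion of `G_q(ω q ^ a)` for non-real `ω` on the unit circle
    (∀ (m : ℕ) (ω : ℂ), ‖ω‖ = 1 → ω.im ≠ 0 → ∀ a : ℝ, 0 < a → a < 1 →
      ∃ R : ℝ → ℂ, (R =O[𝓝[<] (0 : ℝ)] fun h : ℝ => h ^ (m + 1)) ∧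
        ∀ᶠ h : ℝ in 𝓝[<] (0 : ℝ),
          Gfun (Complex.exp h) (ω * Complex.exp ((a : ℂ) * h)) =
            Complex.exp (((Real.pi : ℂ) / 2 * (|Complex.arg ω| : ℝ) - (Real.pi : ℂ) ^ 2 / 4
                - Complex.I * (circleLobachevsky ω : ℂ)) * (h : ℂ)⁻¹
              + ((a : ℂ) - 1 / 2) * ((Real.log |2 * ω.im| : ℂ)
                - Complex.I * ((Real.pi : ℂ) / 2) * (Real.sign ω.im : ℂ))
              + bernoulliValue 2 a * (ω.re : ℂ) / (2 * Complex.I * (ω.im : ℂ)) * (h : ℂ)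
              - ∑ k ∈ Finset.Icc 2 m,
                  2 ^ k * bernoulliValue (k + 1) a / (Nat.factorial (k + 1) : ℂ)
                    * polylog (1 - (k : ℤ)) (ω ^ 2) * (h : ℂ) ^ k
              + R h)) ∧
    -- expansion of the `q`-dilogarithm
    (∀ (m : ℕ) (ω a : ℂ), ‖ω‖ = 1 → ω ≠ 1 → 0 < a.re →
      (fun h : ℝ => qDilog (ω * Complex.exp (a * h)) (Complex.exp h)
          - (-(polylog 2 ω) * (h : ℂ)⁻¹ + (a - 1 / 2) * Complex.log (1 - ω)
            - ∑ k ∈ Finset.Icc 1 m,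
                bernoulliValue (k + 1) a / (Nat.factorial (k + 1) : ℂ)
                  * polylog (1 - (k : ℤ)) ω * (h : ℂ) ^ k))
        =O[𝓝[<] (0 : ℝ)] fun h : ℝ => h ^ (m + 1)) := by
  refine ⟨cConst_asymptotics, ?_, ?_, fun n h h0 => Gfun_neg_exp_eq_zero n h0, ?_, ?_⟩
  · intro m K hK
    obtain ⟨A, hA⟩ := hK.isBounded.exists_norm_le
    obtain ⟨C, δ, hδ, H⟩ := exists_Gfun_exp_expansion m A
    exact ⟨C, δ, hδ, fun h hh h0 a ha han => H h hh h0 a (hA a ha) han⟩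
  · intro m K hK
    obtain ⟨A, hA⟩ := hK.isBounded.exists_norm_le
    obtain ⟨C, δ, hδ, H⟩ := exists_Gfun_exp_expansion m (1 + A)
    refine ⟨C, δ, hδ, fun h hh h0 a ha han => ?_⟩
    obtain ⟨R, hR, e⟩ := H h hh h0 (1 - a)
      ((norm_sub_le _ _).trans (by rw [norm_one]; linarith [hA a ha]))
      (fun n hn => han n (by linear_combination -hn))
    refine ⟨-R, by rwa [norm_neg], ?_⟩
    rw [Gfun_neg_exp, e, ← Complex.exp_neg]
    have hsum : ∑ k ∈ Finset.Icc 1 m, ((bernoulli (2 * k) : ℚ) : ℂ)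
          * bernoulliValue (2 * k + 1) (1 - a) / (2 * (k : ℂ) * (Nat.factorial (2 * k + 1) : ℂ))
          * 2 ^ (2 * k) * (h : ℂ) ^ (2 * k)
        = -∑ k ∈ Finset.Icc 1 m, ((bernoulli (2 * k) : ℚ) : ℂ) * bernoulliValue (2 * k + 1) a
          / (2 * (k : ℂ) * (Nat.factorial (2 * k + 1) : ℂ)) * 2 ^ (2 * k) * (h : ℂ) ^ (2 * k) := by
      rw [← Finset.sum_neg_distrib]
      refine Finset.sum_congr rfl fun k _ => ?_
      rw [bernoulliValue_one_sub, pow_succ, pow_mul]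
      simp only [even_two, Even.neg_pow, one_pow]
      ring
    rw [hsum]
    congr 1
    ring
  · intro m ω hω him a ha0 ha1
    rcases m with _ | m
    -- The linear term in `h` is present even for `m = 0`, so the formula coincides with that for `m
    -- = 1` and the error `h ^ 2` is weakened to `h`.
    · obtain ⟨R, hR, e⟩ := Gfun_circle_asymptotics_of_one_le le_rfl hω him ha0 ha1
      refine ⟨R, hR.trans ?_, e⟩
      refine IsBigO.of_bound 1 ?_
      have h1 : ∀ᶠ h : ℝ in 𝓝[<] (0 : ℝ), -1 < h :=
        eventually_nhdsWithin_of_eventually_nhds (eventually_gt_nhds (by norm_num))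
      filter_upwards [h1, self_mem_nhdsWithin] with h hh h0
      have h0 : h < 0 := h0
      have habs : |h| ≤ 1 := abs_le.2 ⟨hh.le, by linarith⟩
      rw [one_mul, norm_pow, norm_pow, Real.norm_eq_abs]
      exact pow_le_pow_of_le_one (abs_nonneg h) habs (by norm_num)
    · exact Gfun_circle_asymptotics_of_one_le (by omega) hω him ha0 ha1
  · intro m ω a hω hω1 ha
    exact qDilog_sub_expansion_isBigO m hω hω1 ha
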